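/- Let $\pi : X \to B$ be a surface bundle over a surface, that is, a locally trivial fibre bundle whose fibre $F$ and base $B$ are closed oriented surfaces of genus greater than $1$. Let $x_0 \in X$ and let $R = \ker\big(\pi_* : \pi_1(X,x_0) \to \pi_1(B,\pi(x_0))\big)$, which is the fundamental group of the fibre. Conjugation in $\pi_1(X,x_0)$ induces the monodromy morphism $$\varrho : \pi_1(B,\pi(x_0)) \cong \pi_1(X,x_0)/R \longrightarrow \mathrm{Out}(R) = \mathrm{Aut}(R)/\mathrm{Inn}(R).$$ If $\varrho$ is not injective, then $\pi_1(X,x_0)$ contains a subgroup isomorphic to $F_2 \times F_2$, where $F_2$ is the free group of rank $2$. Consequently $\pi_1(X,x_0)$ is not coherent: it has a finitely generated subgroup which is not finitely presented. -/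

import Mathlib

open scoped unitInterval

/-! ### Closed oriented surfaces of genus greater than one -/

/-- The closed unit disc, seen as a polygon with `n` edges whose `k`-th edge is the boundary arc
from `exp (2πi k / n)` to `exp (2πi (k + 1) / n)`.  This is the point of parameter `s ∈ [0, 1]`
on the `k`-th edge. -/
noncomputable def polygonEdge (n k : ℕ) (s : I) : Metric.closedBall (0 : ℂ) 1 :=
  ⟨Complex.exp (((2 * Real.pi * ((k + (s : ℝ)) / n) : ℝ) : ℂ) * Complex.I), by
    simpa only [Metric.mem_closedBall, dist_zero_right] using
      (Complex.norm_exp_ofReal_mul_I _).le⟩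

/-- The edge identifications of the `4 g`-gon with boundary word
`a₁ b₁ a₁⁻¹ b₁⁻¹ ⋯ a_g b_g a_g⁻¹ b_g⁻¹`: the edge `4 j` is glued to the edge `4 j + 2` and the
edge `4 j + 1` to the edge `4 j + 3`, both with reversed direction. -/
inductive PolygonGluing (g : ℕ) :
    Metric.closedBall (0 : ℂ) 1 → Metric.closedBall (0 : ℂ) 1 → Prop
  | a (j : ℕ) (hj : j < g) (s : I) :
      PolygonGluing g (polygonEdge (4 * g) (4 * j) s) (polygonEdge (4 * g) (4 * j + 2) (σ s))
  | b (j : ℕ) (hj : j < g) (s : I) :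
      PolygonGluing g (polygonEdge (4 * g) (4 * j + 1) s) (polygonEdge (4 * g) (4 * j + 3) (σ s))

/-- The closed oriented surface `S_g` of genus `g ≥ 1`, as the quotient of the `4 g`-gon by the
equivalence relation generated by the edge identifications, with the quotient topology. -/
def ModelSurface (g : ℕ) : Type :=
  Quot (PolygonGluing g)

instance (g : ℕ) : TopologicalSpace (ModelSurface g) :=
  inferInstanceAs (TopologicalSpace (Quot (PolygonGluing g)))

/-- `S` is a closed orientable surface of genus greater than one. -/
def IsClosedSurfaceOfGenusGtOne (S : Type*) [TopologicalSpace S] : Prop :=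
  ∃ g : ℕ, 2 ≤ g ∧ Nonempty (S ≃ₜ ModelSurface g)

theorem IsClosedSurfaceOfGenusGtOne.pathConnectedSpace {S : Type*} [TopologicalSpace S]
    (hS : IsClosedSurfaceOfGenusGtOne S) : PathConnectedSpace S := by
  obtain ⟨g, -, ⟨e⟩⟩ := hS
  have h1 : IsPathConnected (Metric.closedBall (0 : ℂ) 1) :=
    (convex_closedBall 0 1).isPathConnected ⟨0, by simp⟩
  have h2 : PathConnectedSpace (Metric.closedBall (0 : ℂ) 1) :=
    isPathConnected_iff_pathConnectedSpace.mp h1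
  have hq : Continuous (fun z : Metric.closedBall (0 : ℂ) 1 =>
      e.symm (Quot.mk (PolygonGluing g) z : ModelSurface g)) :=
    e.symm.continuous.comp continuous_quot_mk
  exact Function.Surjective.pathConnectedSpace
    (e.symm.surjective.comp (Quot.mk_surjective (r := PolygonGluing g))) hq

/-! ### Surface bundles over surfaces -/

/-- `p : X → B` is a locally trivial fibre bundle with fibre `F`. -/
def IsFibreBundle (F : Type*) [TopologicalSpace F] {X B : Type*} [TopologicalSpace X]
    [TopologicalSpace B] (p : X → B) : Prop :=
  ∀ b : B, ∃ e : Bundle.Trivialization F p, b ∈ e.baseSet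

/-- `p : X → B` is a surface bundle over a surface, with fibre `F`: a locally trivial fibre
bundle whose fibre and base are closed orientable surfaces of genus greater than one. -/
structure IsSurfaceBundleOverSurface (F : Type*) [TopologicalSpace F] {X B : Type*}
    [TopologicalSpace X] [TopologicalSpace B] (p : C(X, B)) : Prop where
  fibre : IsClosedSurfaceOfGenusGtOne F
  base : IsClosedSurfaceOfGenusGtOne B
  isFibreBundle : IsFibreBundle F p

section PathLifting

variable {F X B : Type*} [TopologicalSpace F] [TopologicalSpace X] [TopologicalSpace B]

theorem IsFibreBundle.exists_path_lift {p : X → B} (hp : IsFibreBundle F p) (γ : C(I, B))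
    (x : X) (hx : γ 0 = p x) : ∃ Γ : C(I, X), p ∘ Γ = γ ∧ Γ 0 = x := by
  choose T hT using hp
  obtain ⟨t, t_0, t_mono, ⟨n_max, h_max⟩, t_sub⟩ :=
    exists_monotone_Icc_subset_open_cover_unitInterval
      (fun b ↦ (T b).open_baseSet.preimage γ.continuous)
      fun t _ ↦ Set.mem_iUnion.2 ⟨γ t, hT _⟩
  suffices ∀ n, ∃ Γ : I → X, ContinuousOn Γ (Set.Icc 0 (t n)) ∧
      (Set.Icc 0 (t n)).EqOn (p ∘ Γ) γ ∧ Γ 0 = x by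
    obtain ⟨Γ, cont, eqOn, Γ_0⟩ := this n_max
    rw [h_max _ le_rfl] at cont eqOn
    have huniv : (Set.Icc 0 1 : Set I) = Set.univ :=
      Set.eq_univ_iff_forall.mpr fun t ↦ ⟨bot_le, le_top⟩
    exact ⟨⟨Γ, continuousOn_univ.mp (huniv ▸ cont)⟩,
      funext fun _ ↦ eqOn ⟨bot_le, le_top⟩, Γ_0⟩
  intro n
  induction n with
  | zero =>
    refine ⟨fun _ ↦ x, continuous_const.continuousOn, fun t ht ↦ ?_, rfl⟩
    rw [t_0, Set.Icc_self, Set.mem_singleton_iff] at ht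
    subst ht
    exact hx.symm
  | succ n ih =>
    obtain ⟨Γ, cont, eqOn, Γ_0⟩ := ih
    obtain ⟨b, t_sub⟩ := t_sub n
    have pΓtn : p (Γ (t n)) = γ (t n) := eqOn ⟨t_0 ▸ t_mono n.zero_le, le_rfl⟩
    let q := T b
    refine ⟨fun s ↦ if s ≤ t n then Γ s else q.invFun (γ s, (q (Γ (t n))).2),
      .if (fun s hs ↦ ?_) (cont.mono fun _ h ↦ ?_) ?_, fun s hs ↦ ?_, ?_⟩
    · cases frontier_Iic_subset _ hs.2
      rw [← pΓtn]
      refine (q.symm_apply_mk_proj ?_).symm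
      rw [q.mem_source, pΓtn]
      exact t_sub ⟨le_rfl, t_mono n.le_succ⟩
    · rw [closure_le_eq continuous_id' continuous_const] at h
      exact ⟨h.1.1, h.2⟩
    · apply q.continuousOn_invFun.comp
        ((Continuous.prodMk_left _).comp γ.2).continuousOn
      simp_rw [not_le, q.target_eq]
      intro s h
      exact ⟨t_sub ⟨closure_lt_subset_le continuous_const continuous_subtype_val h.2, h.1.2⟩,
        ⟨⟩⟩
    · rw [Function.comp_apply]
      split_ifs with h
      exacts [eqOn ⟨hs.1, h⟩, q.proj_symm_apply' (t_sub ⟨le_of_not_ge h, hs.2⟩)]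
    · dsimp only
      rwa [if_pos (t_0 ▸ t_mono n.zero_le)]

/-- A bundle projection with path connected fibre is surjective on fundamental groups. -/
theorem IsFibreBundle.map_surjective [PathConnectedSpace F] {p : C(X, B)}
    (hp : IsFibreBundle F p) (x₀ : X) :
    Function.Surjective (FundamentalGroup.map p x₀) := by
  intro c
  obtain ⟨γ, rfl⟩ : ∃ γ : Path (p x₀) (p x₀),
      (Path.Homotopic.Quotient.mk γ : Path.Homotopic.Quotient (p x₀) (p x₀)) = c :=
    Quotient.exists_rep c
  obtain ⟨Γ, hΓ, hΓ0⟩ := hp.exists_path_lift γ.toContinuousMap x₀ γ.source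
  have hΓ' : ∀ t, p (Γ t) = γ t := fun t ↦ congrFun hΓ t
  obtain ⟨e, he⟩ := hp (p x₀)
  have h1 : p (Γ 1) = p x₀ := by rw [hΓ', γ.target]
  -- a path in the fibre from the end of the lift to the base point
  let δF : Path (e (Γ 1)).2 (e x₀).2 := PathConnectedSpace.somePath _ _
  have hcont : Continuous fun t : I ↦ e.toOpenPartialHomeomorph.symm (p x₀, δF t) := by
    have : Continuous fun t : I ↦ ((p x₀, δF t) : B × F) := by fun_prop
    refine e.continuousOn_invFun.comp_continuous this fun t ↦ ?_
    rw [e.target_eq]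
    exact ⟨he, trivial⟩
  let δ : Path (Γ 1) x₀ :=
    { toFun := fun t ↦ e.toOpenPartialHomeomorph.symm (p x₀, δF t)
      continuous_toFun := hcont
      source' := by
        rw [δF.source, ← h1]
        exact e.symm_apply_mk_proj (by rw [e.mem_source, h1]; exact he)
      target' := by
        rw [δF.target]
        exact e.symm_apply_mk_proj (by rw [e.mem_source]; exact he) }
  have hδ : ∀ t, p (δ t) = p x₀ := fun t ↦ e.proj_symm_apply' he
  let Γp : Path x₀ (Γ 1) := ⟨Γ, hΓ0, rfl⟩
  refine ⟨(Path.Homotopic.Quotient.mk (Γp.trans δ) : Path.Homotopic.Quotient x₀ x₀), ?_⟩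
  have key : (Γp.trans δ).map p.continuous = γ.trans (Path.refl (p x₀)) := by
    ext t
    simp only [Path.map_coe, Function.comp_apply, Path.trans_apply, Path.refl_apply]
    split_ifs
    · exact hΓ' _
    · exact hδ _
  change (Path.Homotopic.Quotient.mk ((Γp.trans δ).map p.continuous) :
    Path.Homotopic.Quotient (p x₀) (p x₀)) = Path.Homotopic.Quotient.mk γ
  rw [key]
  exact Quotient.sound ⟨Path.Homotopy.transRefl γ⟩

end PathLifting

/-! ### Monodromy -/

instance innerAut_normal (G : Type*) [Group G] :
    ((MulAut.conj : G →* MulAut G).range).Normal := by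
  refine ⟨?_⟩
  rintro _ ⟨x, rfl⟩ φ
  refine ⟨φ x, ?_⟩
  ext y
  simp [MulAut.conj_apply, MulAut.mul_apply]

/-- The group `Out G = Aut G / Inn G` of outer automorphisms. -/
abbrev OuterAut (G : Type*) [Group G] : Type _ :=
  MulAut G ⧸ (MulAut.conj : G →* MulAut G).range

/-- The monodromy morphism `G / R → Out R` of the extension `1 → R → G → G / R → 1`, induced by
the conjugation action of `G` on the normal subgroup `R`. -/
def extensionMonodromy {G : Type*} [Group G] (R : Subgroup G) [R.Normal] : G ⧸ R →* OuterAut R :=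
  QuotientGroup.lift R
    ((QuotientGroup.mk' (MulAut.conj : R →* MulAut R).range).comp (MulAut.conjNormal (H := R)))
    (fun r hr => by
      rw [MonoidHom.mem_ker, MonoidHom.comp_apply, QuotientGroup.mk'_apply,
        QuotientGroup.eq_one_iff]
      refine ⟨⟨r, hr⟩, ?_⟩
      ext y
      simp)

/-- The monodromy morphism `π₁(B) → Out R` of a surface bundle `p : X → B` over a surface, where
`R` is the kernel of `p_* : π₁(X) → π₁(B)`, i.e. the fundamental group of the fibre, and `π₁(B)` is
identified with `π₁(X) / R` through `p_*`. -/
noncomputable def surfaceBundleMonodromy {F X B : Type*} [TopologicalSpace F] [TopologicalSpace X]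
    [TopologicalSpace B] {p : C(X, B)} (hp : IsSurfaceBundleOverSurface F p) (x₀ : X) :
    FundamentalGroup B (p x₀) →* OuterAut (FundamentalGroup.map p x₀).ker :=
  haveI := hp.fibre.pathConnectedSpace
  (extensionMonodromy (FundamentalGroup.map p x₀).ker).comp
    (QuotientGroup.quotientKerEquivOfSurjective (FundamentalGroup.map p x₀)
      (hp.isFibreBundle.map_surjective x₀)).symm.toMonoidHom

/-! ### Coherence -/

/-- A group is coherent if each of its finitely generated subgroups is finitely presented. -/
def IsCoherentGroup (G : Type*) [Group G] : Prop :=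
  ∀ H : Subgroup G, H.FG → Group.IsFinitelyPresented H

/-! ### The product of two free groups of rank two is not coherent -/

/-! Write `G = π₁(X)`, `Q = π₁(B)` and `R = ker (G → Q)`. The two factors `F₂` are found in `R` and
in the centralizer of `R`. If the monodromy is not injective, its kernel `K` is a nontrivial normal
subgroup of the surface group `Q`, so it contains a copy of `F₂`
(`IsClosedSurfaceOfGenusGtOne.exists_injective_of_normal`). An element `x` of `G` over `K` acts on
`R` as some inner automorphism, by `r` say, so `r⁻¹ x` centralizes `R`. As `F₂` is free, lifting two
generators in this way lifts the whole copy into the centralizer. It commutes with any `F₂` inside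
`R`, and the product map from `F₂ × F₂` is injective because the projection to `Q` kills one factor
and is injective on the other (`exists_prod_injective_of_monodromy`). For an `F₂` inside `R`,
exactness of the homotopy sequence is not needed: the kernel of `π₁(F) → π₁(X)` is central
(`IsFibreBundle.homotopic_trans_comm`), and a copy of `F₂` in `π₁(F)` has trivial centre, so it
survives in `π₁(X)`. Both uses of surface groups rest on computing `π₁` of the glued polygon as a
semidirect product of a free group of infinite rank by `ℤ`. A nontrivial normal subgroup meets the
free part nontrivially, and a nontrivial normal subgroup of a nonabelian free group is not abelian,
so by Nielsen–Schreier it contains `F₂`. The computation views the surface as a quotient of the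
strip `I × ℝ` of polar coordinates. Null-homotopic charts show that the edge identifications
generate `π₁`; a covering built from locally constant potentials with values in the abstract surface
group shows that there are no further relations. Finally `F₂ × F₂` is not coherent: the fibre
product `F₂ ×_ℤ F₂` is generated by three elements `a, b, t`, its relations are the commutators `[a,
tⁱ b t⁻ⁱ]` for all `i`, and permutations of `ℤ` show that no finite range of `i` suffices. -/

theorem IsCoherentGroup.of_injective {G G' : Type*} [Group G] [Group G'] (hG : IsCoherentGroup G)
    (f : G' →* G) (hf : Function.Injective f) : IsCoherentGroup G' := fun H hH =>
  have := (Group.fg_iff_subgroup_fg H).mpr hH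
  have := hG (H.map f) ((Group.fg_iff_subgroup_fg _).mp
    (Group.fg_of_surjective (f.subgroupMap_surjective H)))
  Group.IsFinitelyPresented.equiv (H.equivMapOfInjective f hf).symm

/-- If a finitely presented group is a quotient of a free group of finite rank whose kernel is an
increasing union of normal subgroups, then the union is stationary. -/
theorem ker_le_of_isFinitelyPresented {α H : Type*} [Finite α] [Group H]
    [hH : Group.IsFinitelyPresented H] (pr : FreeGroup α →* H) (hpr : Function.Surjective pr)
    (N : ℕ → Subgroup (FreeGroup α)) (hN : ∀ n, (N n).Normal) (hmono : Monotone N)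
    (hker : ∀ w ∈ pr.ker, ∃ n, w ∈ N n) : ∃ n, pr.ker ≤ N n := by
  obtain ⟨m, ρ, hρ, S, hS, hSk⟩ := hH.out
  choose lift₁ hlift₁ using fun x => hpr (ρ (FreeGroup.of x))
  choose lift₂ hlift₂ using fun x => hρ (pr (FreeGroup.of x))
  let f₁ : FreeGroup (Fin m) →* FreeGroup α := FreeGroup.lift lift₁
  let f₂ : FreeGroup α →* FreeGroup (Fin m) := FreeGroup.lift lift₂
  have h₁ : pr.comp f₁ = ρ := by ext x; simp [f₁, hlift₁]
  have h₂ : ρ.comp f₂ = pr := by ext x; simp [f₂, hlift₂]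
  have h₁' : ∀ w, pr (f₁ w) = ρ w := fun w => DFunLike.congr_fun h₁ w
  have h₂' : ∀ w, ρ (f₂ w) = pr w := fun w => DFunLike.congr_fun h₂ w
  -- Modulo `T`, the endomorphism `f₁ ∘ f₂` is the identity and `f₁` kills the relators `S`, so any
  -- normal subgroup containing `T` contains `ker pr`. Being finite, `T` lies in a single `N n`.
  let T : Set (FreeGroup α) :=
    f₁ '' S ∪ Set.range fun x => (FreeGroup.of x)⁻¹ * f₁ (f₂ (FreeGroup.of x))
  have hT : T.Finite := (hS.image _).union (Set.finite_range _)
  have hTk : ∀ w ∈ T, w ∈ pr.ker := by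
    rintro _ (⟨s, hs, rfl⟩ | ⟨x, rfl⟩)
    · rw [MonoidHom.mem_ker, h₁', ← MonoidHom.mem_ker, ← hSk]
      exact Subgroup.subset_normalClosure hs
    · rw [MonoidHom.mem_ker, map_mul, h₁', h₂', map_inv, inv_mul_cancel]
  choose! i hi using fun w hw => hker w (hTk w hw)
  obtain ⟨n, hn⟩ := (hT.image i).bddAbove
  have hTn : T ⊆ N n := fun w hw => hmono (hn (Set.mem_image_of_mem i hw)) (hi w hw)
  refine ⟨n, fun w hw => ?_⟩
  have := hN n
  have h1 : (QuotientGroup.mk' (N n)).comp (f₁.comp f₂) = QuotientGroup.mk' (N n) := by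
    ext x
    exact (QuotientGroup.eq.mpr (hTn (Or.inr ⟨x, rfl⟩))).symm
  have h2 : Subgroup.normalClosure S ≤ (N n).comap f₁ :=
    Subgroup.normalClosure_le_normal fun s hs => hTn (Or.inl ⟨s, hs, rfl⟩)
  have h3 : f₂ w ∈ Subgroup.normalClosure S := by
    rw [hSk, MonoidHom.mem_ker, h₂']; exact hw
  have h4 := DFunLike.congr_fun h1 w
  have h5 : QuotientGroup.mk' (N n) (f₁ (f₂ w)) = 1 := (QuotientGroup.eq_one_iff _).mpr (h2 h3)
  exact (QuotientGroup.eq_one_iff _).mp (h4.symm.trans h5)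

/-! ### The fibre product `F₂ ×_ℤ F₂` and its infinitely many relators. -/

namespace FreeProduct

open scoped commutatorElement

/-- The homomorphism onto `F₂ ×_ℤ F₂` from the free group on `a, b, t = 0, 1, 2`. -/
def toProd : FreeGroup (Fin 3) →* FreeGroup (Fin 2) × FreeGroup (Fin 2) :=
  FreeGroup.lift ![(FreeGroup.of 0, 1), (1, FreeGroup.of 0), (FreeGroup.of 1, FreeGroup.of 1)]

/-- The exponent sum of the second generator. -/
def exponent : FreeGroup (Fin 2) →* Multiplicative ℤ :=
  FreeGroup.lift ![1, Multiplicative.ofAdd 1]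

variable {Q : Type*} [Group Q] (a b t : Q)

/-- Since `b` commutes with every `tⁱ a t⁻ⁱ` and `t` shifts these conjugates, a word in `b, t` acts
on them only through its exponent sum in `t`. -/
theorem conj_lift_eq (h : ∀ i : ℤ, Commute a (t ^ i * b * t ^ (-i))) (v : FreeGroup (Fin 2)) :
    ∀ i : ℤ, FreeGroup.lift ![b, t] v * (t ^ i * a * t ^ (-i)) * (FreeGroup.lift ![b, t] v)⁻¹ =
      t ^ (i + (exponent v).toAdd) * a * t ^ (-(i + (exponent v).toAdd)) := by
  have hb : ∀ i : ℤ, b * (t ^ i * a * t ^ (-i)) * b⁻¹ = t ^ i * a * t ^ (-i) := by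
    intro i
    have := (h (-i)).eq
    rw [mul_inv_eq_iff_eq_mul]
    calc b * (t ^ i * a * t ^ (-i)) = t ^ i * (t ^ (-i) * b * t ^ (-(-i)) * a) * t ^ (-i) := by
          simp only [zpow_neg]; group
      _ = t ^ i * (a * (t ^ (-i) * b * t ^ (-(-i)))) * t ^ (-i) := by rw [this]
      _ = _ := by simp only [zpow_neg]; group
  have hinv : ∀ u : FreeGroup (Fin 2),
      (∀ i : ℤ, FreeGroup.lift ![b, t] u * (t ^ i * a * t ^ (-i)) * (FreeGroup.lift ![b, t] u)⁻¹ =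
        t ^ (i + (exponent u).toAdd) * a * t ^ (-(i + (exponent u).toAdd))) →
      ∀ i : ℤ, FreeGroup.lift ![b, t] u⁻¹ * (t ^ i * a * t ^ (-i)) *
        (FreeGroup.lift ![b, t] u⁻¹)⁻¹ =
        t ^ (i + (exponent u⁻¹).toAdd) * a * t ^ (-(i + (exponent u⁻¹).toAdd)) := by
    intro u hu i
    have := hu (i - (exponent u).toAdd)
    rw [sub_add_cancel] at this
    rw [← this, map_inv, map_inv, toAdd_inv, ← sub_eq_add_neg]
    group
  induction v using FreeGroup.induction_on with
  | C1 => intro i; simp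
  | of x =>
    intro i
    fin_cases x
    · simpa [exponent] using hb i
    · simp [exponent, zpow_add, mul_assoc]
      group
  | inv_of x ih => exact hinv _ ih
  | mul u v hu hv =>
    intro i
    have h1 := hv i
    have h2 := hu (i + (exponent v).toAdd)
    rw [← h1] at h2
    rw [map_mul, map_mul, toAdd_mul, add_comm (exponent u).toAdd, ← add_assoc, ← h2]
    group

/-- The relations allow every `a` to be moved to the left, so the value of a word depends only on
its image in the product; this is why the commutators exhaust the kernel of `toProd`. The normal
form `θ` is compatible with right multiplication by each generator, and induction on the word does
the rest. -/
theorem lift_eq_of_toProd (h : ∀ i : ℤ, Commute a (t ^ i * b * t ^ (-i))) (w : FreeGroup (Fin 3)) :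
    FreeGroup.lift ![a, b, t] w = FreeGroup.lift ![a, t] (toProd w).1 *
      t ^ (-(exponent (toProd w).2).toAdd) * FreeGroup.lift ![b, t] (toProd w).2 := by
  let θ : FreeGroup (Fin 2) × FreeGroup (Fin 2) → Q := fun p =>
    FreeGroup.lift ![a, t] p.1 * t ^ (-(exponent p.2).toAdd) * FreeGroup.lift ![b, t] p.2
  have key : ∀ x p, θ (p * toProd (FreeGroup.of x)) = θ p * ![a, b, t] x := by
    intro x p
    have hc := conj_lift_eq a b t h p.2 (-(exponent p.2).toAdd)
    rw [neg_add_cancel, neg_zero, zpow_zero, one_mul, mul_one, mul_inv_eq_iff_eq_mul] at hc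
    fin_cases x
    -- The factor `t ^ (-e) * v(b, t)` has exponent sum zero in `t`, hence commutes with `a`.
    · have h2 : t ^ (-(exponent p.2).toAdd) * FreeGroup.lift ![b, t] p.2 * a =
          a * (t ^ (-(exponent p.2).toAdd) * FreeGroup.lift ![b, t] p.2) := by
        have hc' := conj_lift_eq a b t h p.2 0
        rw [zpow_zero, neg_zero, zpow_zero, one_mul, mul_one, zero_add,
          mul_inv_eq_iff_eq_mul] at hc'
        rw [mul_assoc, hc']
        simp only [zpow_neg]
        group
      simp only [θ, toProd]
      simp [mul_assoc] at h2 ⊢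
      exact h2.symm
    · simp [θ, toProd, mul_assoc, exponent]
    · simp [θ, toProd, mul_assoc, exponent, zpow_add]
  have key' : ∀ x p, θ (p * (toProd (FreeGroup.of x))⁻¹) = θ p * (![a, b, t] x)⁻¹ := by
    intro x p
    rw [eq_mul_inv_iff_mul_eq, ← key, inv_mul_cancel_right]
  suffices ∀ w p, θ (p * toProd w) = θ p * FreeGroup.lift ![a, b, t] w by
    simpa [θ] using (this w 1).symm
  intro w
  induction w using FreeGroup.induction_on with
  | C1 => simp
  | of x => intro p; rw [key]; simp
  | inv_of x _ => intro p; rw [map_inv, key']; simp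
  | mul u v hu hv => intro p; rw [map_mul, ← mul_assoc, hv, hu, map_mul, mul_assoc]

/-- The commutator `[a, tⁱ b t⁻ⁱ]`. -/
def relator (i : ℤ) : FreeGroup (Fin 3) :=
  ⁅(FreeGroup.of 0 : FreeGroup (Fin 3)),
    FreeGroup.of 2 ^ i * FreeGroup.of 1 * FreeGroup.of 2 ^ (-i)⁆

theorem map_relator (f : FreeGroup (Fin 3) →* Q) (i : ℤ) : f (relator i) =
    ⁅f (FreeGroup.of 0), f (FreeGroup.of 2) ^ i * f (FreeGroup.of 1) *
      f (FreeGroup.of 2) ^ (-i)⁆ := by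
  simp only [relator, map_commutatorElement, map_mul, map_zpow]

/-- The relations `[a, tⁱ b t⁻ⁱ]` for `|i| ≤ n`. -/
def relators (n : ℕ) : Set (FreeGroup (Fin 3)) :=
  {w | ∃ i : ℤ, |i| ≤ n ∧ w = relator i}

theorem relators_mono : Monotone relators := by
  rintro m n h _ ⟨i, hi, rfl⟩
  exact ⟨i, hi.trans (by exact_mod_cast h), rfl⟩

theorem relators_le_ker (n : ℕ) : Subgroup.normalClosure (relators n) ≤ toProd.ker := by
  refine Subgroup.normalClosure_le_normal ?_
  rintro _ ⟨i, -, rfl⟩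
  rw [SetLike.mem_coe, MonoidHom.mem_ker, map_relator, commutatorElement_eq_one_iff_commute]
  have h : ∀ j : ℤ, (toProd (FreeGroup.of 2) ^ j) = (FreeGroup.of 1 ^ j, FreeGroup.of 1 ^ j) := by
    intro j
    simp [toProd]
  simp only [h]
  simp [toProd, Commute, SemiconjBy]

theorem exists_mem_normalClosure_relators (w : FreeGroup (Fin 3)) (hw : w ∈ toProd.ker) :
    ∃ n, w ∈ Subgroup.normalClosure (relators n) := by
  have hU : Directed (· ≤ ·) fun n => Subgroup.normalClosure (relators n) :=
    (show Monotone fun n => Subgroup.normalClosure (relators n) from fun m n h =>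
      Subgroup.normalClosure_mono (relators_mono h)).directed_le
  let U : Subgroup (FreeGroup (Fin 3)) := ⨆ n, Subgroup.normalClosure (relators n)
  have hmem : ∀ w, w ∈ U ↔ ∃ n, w ∈ Subgroup.normalClosure (relators n) :=
    fun w => Subgroup.mem_iSup_of_directed hU
  have : U.Normal := ⟨fun w hw g => by
    obtain ⟨n, hn⟩ := (hmem w).mp hw
    exact (hmem _).mpr ⟨n, Subgroup.normalClosure_normal.conj_mem w hn g⟩⟩
  let q := QuotientGroup.mk' U
  have h := lift_eq_of_toProd (q (FreeGroup.of 0)) (q (FreeGroup.of 1)) (q (FreeGroup.of 2))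
    (fun i => by
      rw [← commutatorElement_eq_one_iff_commute, ← map_relator]
      exact (QuotientGroup.eq_one_iff _).mpr ((hmem _).mpr ⟨i.natAbs,
          Subgroup.subset_normalClosure ⟨i, by simp, rfl⟩⟩)) w
  have hq : FreeGroup.lift ![q (FreeGroup.of 0), q (FreeGroup.of 1), q (FreeGroup.of 2)] = q := by
    ext x; fin_cases x <;> simp
  rw [hq, MonoidHom.mem_ker.mp hw] at h
  refine (hmem w).mp ((QuotientGroup.eq_one_iff _).mp (h.trans ?_))
  simp

/-- In permutations of `ℤ`, let `t` be the translation and `a`, `b` transpositions. For `|i| ≤ n`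
the conjugate `tⁱ b t⁻ⁱ` moves one point in `[-2n - 1, -1]` and one in `[2n + 3, 4n + 3]`, thus
avoids the support `{0, 10n + 10}` of `a`. For `i = n + 1` it is the transposition of `0` and `4n +
4`, which shares exactly one point with `a` and does not commute with it. -/
theorem relator_notMem (n : ℕ) : relator (n + 1) ∉ Subgroup.normalClosure (relators n) := by
  let a : Equiv.Perm ℤ := Equiv.swap 0 (10 * n + 10)
  let b : Equiv.Perm ℤ := Equiv.swap (-(n + 1)) (3 * n + 3)
  let t : Equiv.Perm ℤ := Equiv.addRight 1
  have ht : ∀ i x : ℤ, (t ^ i) x = x + i := by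
    intro i x
    simp [t]
  have hconj : ∀ i : ℤ, t ^ i * b * t ^ (-i) = Equiv.swap (-(n + 1) + i) (3 * n + 3 + i) := by
    intro i
    rw [zpow_neg]
    have := Equiv.swap_apply_apply (t ^ i) (-(n + 1)) (3 * n + 3)
    rw [ht, ht] at this
    exact this.symm
  let f : FreeGroup (Fin 3) →* Equiv.Perm ℤ := FreeGroup.lift ![a, b, t]
  have hf : ∀ i : ℤ, f (relator i) = ⁅a, Equiv.swap (-(n + 1) + i) (3 * n + 3 + i)⁆ := by
    intro i
    rw [← hconj, map_relator]
    simp [f]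
  have hle : Subgroup.normalClosure (relators n) ≤ f.ker := by
    refine Subgroup.normalClosure_le_normal ?_
    rintro _ ⟨i, hi, rfl⟩
    rw [abs_le] at hi
    rw [SetLike.mem_coe, MonoidHom.mem_ker, hf, commutatorElement_eq_one_iff_commute]
    refine (Equiv.Perm.disjoint_iff_eq_or_eq.mpr fun x => ?_).commute
    by_cases hx : x = 0 ∨ x = 10 * n + 10
    · exact Or.inr (Equiv.swap_apply_of_ne_of_ne (by lia) (by lia))
    · exact Or.inl (Equiv.swap_apply_of_ne_of_ne (by tauto) (by tauto))
  intro hmem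
  have h1 := MonoidHom.mem_ker.mp (hle hmem)
  rw [hf, commutatorElement_eq_one_iff_mul_comm] at h1
  have h2 := DFunLike.congr_fun h1 0
  simp only [Equiv.Perm.mul_apply, a, neg_add_cancel] at h2
  rw [Equiv.swap_apply_left, Equiv.swap_apply_left, Equiv.swap_apply_of_ne_of_ne (by lia) (by lia),
    Equiv.swap_apply_of_ne_of_ne (by lia) (by lia)] at h2
  lia

theorem not_isCoherentGroup :
    ¬ IsCoherentGroup (FreeGroup (Fin 2) × FreeGroup (Fin 2)) := by
  intro h
  have : Group.IsFinitelyPresented toProd.range :=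
    h _ ((Group.fg_iff_subgroup_fg _).mp inferInstance)
  obtain ⟨n, hn⟩ := ker_le_of_isFinitelyPresented toProd.rangeRestrict
    toProd.rangeRestrict_surjective (fun n => Subgroup.normalClosure (relators n))
    (fun n => Subgroup.normalClosure_normal)
    (fun m n h => Subgroup.normalClosure_mono (relators_mono h))
    (fun w hw => exists_mem_normalClosure_relators w (by rwa [MonoidHom.ker_rangeRestrict] at hw))
  rw [MonoidHom.ker_rangeRestrict] at hn
  refine relator_notMem n (hn (relators_le_ker (n + 1) ?_))
  exact Subgroup.subset_normalClosure ⟨n + 1, by rw [abs_of_nonneg (by positivity)]; simp, rfl⟩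

end FreeProduct

/-! ### Subgroups of free groups -/

theorem FreeGroup.commute_of_subsingleton {α : Type*} [Subsingleton α] (x y : FreeGroup α) :
    Commute x y := by
  rcases isEmpty_or_nonempty α with h | ⟨⟨a⟩⟩
  · exact (Subsingleton.elim x 1) ▸ Commute.one_left y
  · let _ : Unique α := ⟨⟨a⟩, fun b => Subsingleton.elim b a⟩
    refine FreeGroup.mulEquivIntOfUnique.injective ?_
    rw [_root_.map_mul, _root_.map_mul, mul_comm]

/-- By Nielsen–Schreier `H` is free; as it is not abelian its basis has two distinct elements, and
these span a free group of rank two. -/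
theorem FreeGroup.exists_injective_of_not_commute {α : Type*} (H : Subgroup (FreeGroup α))
    (hH : ∃ x ∈ H, ∃ y ∈ H, ¬ Commute x y) :
    ∃ f : FreeGroup (Fin 2) →* FreeGroup α, Function.Injective f ∧ ∀ w, f w ∈ H := by
  let e := IsFreeGroup.mulEquiv H
  obtain ⟨x, hx, y, hy, hxy⟩ := hH
  have hns : ¬ Subsingleton (IsFreeGroup.Generators H) := by
    intro hs
    refine hxy ?_
    have h1 : Commute (⟨x, hx⟩ : H) ⟨y, hy⟩ := by
      have := (FreeGroup.commute_of_subsingleton (e.symm ⟨x, hx⟩) (e.symm ⟨y, hy⟩)).map e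
      simpa using this
    exact h1.map H.subtype
  obtain ⟨i, j, hij⟩ := not_subsingleton_iff_nontrivial.mp hns |>.exists_pair_ne
  refine ⟨H.subtype.comp (e.toMonoidHom.comp (FreeGroup.map ![i, j])), ?_, fun w => (e _).2⟩
  refine H.subtype_injective.comp (e.injective.comp (FreeGroup.map_injective ?_))
  intro a b
  fin_cases a <;> fin_cases b <;> simp [hij, hij.symm]

theorem FreeGroup.not_commute_of_ne {α : Type*} {i j : α} (h : i ≠ j) :
    ¬ Commute (FreeGroup.of i) (FreeGroup.of j) := by
  classical
  intro hc
  -- Two overlapping transpositions in `S₃` do not commute.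
  let f : FreeGroup α →* Equiv.Perm (Fin 3) :=
    FreeGroup.lift fun x => if x = i then Equiv.swap 0 1 else Equiv.swap 1 2
  have := (hc.map f).eq
  simp only [f, FreeGroup.lift_apply_of, if_true, if_neg h.symm] at this
  exact absurd this (by decide)

/-- By Nielsen–Schreier again: an abelian subgroup is free on at most one element. -/
theorem FreeGroup.exists_zpowers_of_commute {α : Type*} (H : Subgroup (FreeGroup α))
    (hH : ∀ x ∈ H, ∀ y ∈ H, Commute x y) : ∃ c ∈ H, ∀ x ∈ H, ∃ i : ℤ, c ^ i = x := by
  let e := IsFreeGroup.mulEquiv H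
  have hs : Subsingleton (IsFreeGroup.Generators H) := by
    refine ⟨fun i j => by_contra fun hij => FreeGroup.not_commute_of_ne hij ?_⟩
    refine e.injective ?_
    rw [_root_.map_mul, _root_.map_mul]
    exact Subtype.ext (hH _ (e (FreeGroup.of i)).2 _ (e (FreeGroup.of j)).2)
  rcases isEmpty_or_nonempty (IsFreeGroup.Generators H) with h | ⟨⟨a⟩⟩
  · refine ⟨1, H.one_mem, fun x hx => ⟨0, ?_⟩⟩
    have h1 : (⟨x, hx⟩ : H) = 1 := e.symm.injective (Subsingleton.elim _ _)
    simpa using (congrArg Subtype.val h1).symm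
  · let _ : Unique (IsFreeGroup.Generators H) := ⟨⟨a⟩, fun b => Subsingleton.elim b a⟩
    let u : H ≃* Multiplicative ℤ := e.symm.trans FreeGroup.mulEquivIntOfUnique
    refine ⟨u.symm (.ofAdd 1), (u.symm _).2, fun x hx => ⟨(u ⟨x, hx⟩).toAdd, ?_⟩⟩
    have h1 : (u.symm (.ofAdd 1)) ^ (u ⟨x, hx⟩).toAdd = ⟨x, hx⟩ := by
      rw [← map_zpow, MulEquiv.symm_apply_eq, ← ofAdd_zsmul]
      simp
    exact congrArg Subtype.val h1

theorem FreeGroup.exists_zpow_eq_zpow_of_commute {α : Type*} {x y : FreeGroup α}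
    (h : Commute x y) (hx : x ≠ 1) (hy : y ≠ 1) :
    ∃ i j : ℤ, i ≠ 0 ∧ j ≠ 0 ∧ x ^ i = y ^ j := by
  have hc : ∀ u ∈ Subgroup.closure {x, y}, ∀ v ∈ Subgroup.closure {x, y}, Commute u v := by
    intro u hu v hv
    induction hu, hv using Subgroup.closure_induction₂ with
    | mem u v hu hv =>
      rcases hu with rfl | rfl <;> rcases hv with rfl | rfl
      exacts [Commute.refl _, h, h.symm, Commute.refl _]
    | one_left => exact Commute.one_left _
    | one_right => exact Commute.one_right _
    | mul_left _ _ _ _ _ _ h1 h2 => exact h1.mul_left h2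
    | mul_right _ _ _ _ _ _ h1 h2 => exact h1.mul_right h2
    | inv_left _ _ _ _ h => exact h.inv_left
    | inv_right _ _ _ _ h => exact h.inv_right
  obtain ⟨c, -, hc⟩ := FreeGroup.exists_zpowers_of_commute _ hc
  obtain ⟨i, rfl⟩ := hc x (Subgroup.subset_closure (by simp))
  obtain ⟨j, rfl⟩ := hc y (Subgroup.subset_closure (by simp))
  refine ⟨j, i, ?_, ?_, ?_⟩
  · rintro rfl; simp at hy
  · rintro rfl; simp at hx
  · rw [← zpow_mul, ← zpow_mul, mul_comm]

/-- An abelian normal `M` would be cyclic, generated by `m` say. Each free generator conjugates `m`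
to `m` or `m⁻¹`, so its square commutes with `m` and it has a nontrivial power in common with `m`.
Two distinct free generators would then have a nontrivial common power. -/
theorem FreeGroup.not_commute_of_normal {α : Type*} [Nontrivial α] (M : Subgroup (FreeGroup α))
    [hM : M.Normal] (hne : M ≠ ⊥) : ∃ x ∈ M, ∃ y ∈ M, ¬ Commute x y := by
  classical
  by_contra! hcomm
  obtain ⟨m, hm, hgen⟩ := FreeGroup.exists_zpowers_of_commute M hcomm
  have hm1 : m ≠ 1 := by
    rintro rfl
    refine hne ((Subgroup.eq_bot_iff_forall _).mpr fun x hx => ?_)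
    obtain ⟨i, rfl⟩ := hgen x hx
    exact one_zpow i
  have key : ∀ a : α, ∃ i j : ℤ, i ≠ 0 ∧ j ≠ 0 ∧ m ^ i = FreeGroup.of a ^ j := by
    intro a
    obtain ⟨k, hk⟩ := hgen _ (hM.conj_mem m hm (FreeGroup.of a))
    obtain ⟨l, hl⟩ := hgen _ (hM.conj_mem m hm (FreeGroup.of a)⁻¹)
    -- Conjugation by `a` and by `a⁻¹` raise `m` to the powers `k` and `l`; they are mutually
    -- inverse, so `k * l = 1`.
    have h1 : m ^ (k * l) = m ^ (1 : ℤ) := by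
      rw [mul_comm, zpow_mul, hl, conj_zpow, hk]
      group
    have h2 : k * k = 1 := by
      have h3 := injective_zpow_iff_not_isOfFinOrder.mpr
        (not_isOfFinOrder_of_isMulTorsionFree hm1) h1
      rcases Int.eq_one_or_neg_one_of_mul_eq_one h3 with rfl | rfl <;> rfl
    -- The square takes care of the case `k = -1`.
    have h4 : Commute m (FreeGroup.of a ^ 2) := by
      have h5 : FreeGroup.of a ^ 2 * m * (FreeGroup.of a ^ 2)⁻¹ = m :=
        calc FreeGroup.of a ^ 2 * m * (FreeGroup.of a ^ 2)⁻¹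
            = FreeGroup.of a * (FreeGroup.of a * m * (FreeGroup.of a)⁻¹) * (FreeGroup.of a)⁻¹ := by
              simp only [pow_two, mul_inv_rev, mul_assoc]
          _ = m := by rw [← hk, ← conj_zpow, ← hk, ← zpow_mul, h2, zpow_one]
      exact (mul_inv_eq_iff_eq_mul.mp h5).symm
    obtain ⟨i, j, hi, hj, hij⟩ := FreeGroup.exists_zpow_eq_zpow_of_commute h4 hm1
      (fun h => by simp at h)
    refine ⟨i, 2 * j, hi, by lia, hij.trans ?_⟩
    rw [zpow_mul]; rfl
  obtain ⟨a, b, hab⟩ := exists_pair_ne α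
  obtain ⟨i, j, hi, hj, hij⟩ := key a
  obtain ⟨k, l, hk, hl, hkl⟩ := key b
  -- The exponent sum in `a` separates a power of `a` from a power of `b`.
  let f : FreeGroup α →* Multiplicative ℤ :=
    FreeGroup.lift fun x => if x = a then .ofAdd 1 else 1
  have h1 : (FreeGroup.of a ^ j) ^ k = (FreeGroup.of b ^ l) ^ i := by
    rw [← hij, ← hkl, ← zpow_mul, ← zpow_mul, mul_comm]
  have h2 := congrArg f h1
  have h3 : f (FreeGroup.of a) = .ofAdd 1 := by simp [f]
  have h4 : f (FreeGroup.of b) = 1 := by simp [f, hab.symm]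
  rw [map_zpow, map_zpow, map_zpow, map_zpow, h3, h4, one_zpow, one_zpow, ← zpow_mul,
    ← ofAdd_zsmul, ofAdd_eq_one, smul_eq_mul, mul_one] at h2
  exact mul_ne_zero hj hk h2

theorem FreeGroup.exists_injective_of_normal {α : Type*} [Nontrivial α]
    (M : Subgroup (FreeGroup α)) [M.Normal] (hne : M ≠ ⊥) :
    ∃ f : FreeGroup (Fin 2) →* FreeGroup α, Function.Injective f ∧ ∀ w, f w ∈ M :=
  FreeGroup.exists_injective_of_not_commute M (FreeGroup.not_commute_of_normal M hne)

/-! ### Surface groups as semidirect products -/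

/-- The left-handed product of the commutators `bⱼ aⱼ⁻¹ bⱼ⁻¹ aⱼ`. -/
def surfaceWord {G : Type*} [Group G] (a b : ℕ → G) : ℕ → G
  | 0 => 1
  | j + 1 => b j * (a j)⁻¹ * (b j)⁻¹ * a j * surfaceWord a b j

theorem map_surfaceWord {G G' : Type*} [Group G] [Group G'] (f : G →* G') (a b : ℕ → G) (j : ℕ) :
    f (surfaceWord a b j) = surfaceWord (fun i => f (a i)) (fun i => f (b i)) j := by
  induction j with
  | zero => simp [surfaceWord]
  | succ j ih => simp [surfaceWord, ih]

theorem surfaceWord_congr {G : Type*} [Group G] {a b a' b' : ℕ → G} {n : ℕ}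
    (ha : ∀ j < n, a j = a' j) (hb : ∀ j < n, b j = b' j) :
    surfaceWord a b n = surfaceWord a' b' n := by
  induction n with
  | zero => rfl
  | succ j ih =>
    rw [surfaceWord, surfaceWord, ha j (by lia), hb j (by lia),
      ih (fun i hi => ha i (by lia)) (fun i hi => hb i (by lia))]

/-- Isolates the commutator of index zero, since `a₀` and `b₀` play a special role in the splitting
over `ℤ`. -/
theorem surfaceWord_succ' {G : Type*} [Group G] (a b : ℕ → G) (j : ℕ) :
    surfaceWord a b (j + 1) = surfaceWord (fun i => a (i + 1)) (fun i => b (i + 1)) j *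
      (b 0 * (a 0)⁻¹ * (b 0)⁻¹ * a 0) := by
  induction j with
  | zero => simp [surfaceWord]
  | succ j ih => rw [surfaceWord, ih, surfaceWord]; simp only [mul_assoc]

namespace SurfaceGroup

/-- The free kernel of the homomorphism of the surface group of genus `h + 1` onto `ℤ` that counts
`b₀`: it is free on `a₀` and on the conjugates by `b₀ⁱ` of the other generators. -/
abbrev Kernel (h : ℕ) : Type := FreeGroup (Option ((Fin h × Bool) × ℤ))

/-- The conjugate by `b₀ⁱ` of the generator `a_{j+1}` or `b_{j+1}`. -/
def kernelGen (h : ℕ) (s : Bool) (i : ℤ) (j : ℕ) : Kernel h :=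
  if hj : j < h then FreeGroup.of (some ((⟨j, hj⟩, s), i)) else 1

/-- The product of the commutators of positive index, conjugated by `b₀ⁱ`. -/
def tail (h : ℕ) (i : ℤ) : Kernel h :=
  surfaceWord (kernelGen h false i) (kernelGen h true i) h

/-- Conjugation by `b₀` on the kernel. -/
def shiftHom (h : ℕ) : Kernel h →* Kernel h :=
  -- The surface relation `tail * (b₀ a₀⁻¹ b₀⁻¹ a₀) = 1`, solved for the conjugate of `a₀`, reads
  -- `b₀ a₀ b₀⁻¹ = a₀ * tail`.
  FreeGroup.lift fun x => x.elim (FreeGroup.of none * tail h 0)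
    fun y => FreeGroup.of (some (y.1, y.2 + 1))

/-- Conjugation by `b₀⁻¹` on the kernel. -/
def shiftInvHom (h : ℕ) : Kernel h →* Kernel h :=
  FreeGroup.lift fun x => x.elim (FreeGroup.of none * (tail h (-1))⁻¹)
    fun y => FreeGroup.of (some (y.1, y.2 - 1))

theorem shiftHom_kernelGen (h : ℕ) (s : Bool) (i : ℤ) (j : ℕ) :
    shiftHom h (kernelGen h s i j) = kernelGen h s (i + 1) j := by
  unfold kernelGen
  split_ifs <;> simp [shiftHom]

theorem shiftInvHom_kernelGen (h : ℕ) (s : Bool) (i : ℤ) (j : ℕ) :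
    shiftInvHom h (kernelGen h s i j) = kernelGen h s (i - 1) j := by
  unfold kernelGen
  split_ifs <;> simp [shiftInvHom]

theorem shiftHom_tail (h : ℕ) (i : ℤ) : shiftHom h (tail h i) = tail h (i + 1) := by
  simp only [tail, map_surfaceWord, shiftHom_kernelGen]

theorem shiftInvHom_tail (h : ℕ) (i : ℤ) : shiftInvHom h (tail h i) = tail h (i - 1) := by
  simp only [tail, map_surfaceWord, shiftInvHom_kernelGen]

theorem shiftHom_none (h : ℕ) :
    shiftHom h (FreeGroup.of none) = FreeGroup.of none * tail h 0 := by
  simp [shiftHom]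

theorem shiftInvHom_none (h : ℕ) :
    shiftInvHom h (FreeGroup.of none) = FreeGroup.of none * (tail h (-1))⁻¹ := by
  simp [shiftInvHom]

theorem shiftHom_some (h : ℕ) (y : Fin h × Bool) (i : ℤ) :
    shiftHom h (FreeGroup.of (some (y, i))) = FreeGroup.of (some (y, i + 1)) := by
  simp [shiftHom]

theorem shiftInvHom_some (h : ℕ) (y : Fin h × Bool) (i : ℤ) :
    shiftInvHom h (FreeGroup.of (some (y, i))) = FreeGroup.of (some (y, i - 1)) := by
  simp [shiftInvHom]

/-- Conjugation by `b₀` as an automorphism of the kernel. -/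
def shift (h : ℕ) : MulAut (Kernel h) :=
  MonoidHom.toMulEquiv (shiftHom h) (shiftInvHom h)
    (by
      ext (_ | ⟨y, i⟩)
      · simp [shiftHom_none, shiftInvHom_none, shiftInvHom_tail]
      · simp [shiftHom_some, shiftInvHom_some])
    (by
      ext (_ | ⟨y, i⟩)
      · simp [shiftHom_none, shiftInvHom_none, shiftHom_tail]
      · simp [shiftHom_some, shiftInvHom_some])

theorem shift_apply (h : ℕ) (x : Kernel h) : shift h x = shiftHom h x := rfl

theorem shift_zpow_some (h : ℕ) (y : Fin h × Bool) (i j : ℤ) :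
    (shift h ^ j) (FreeGroup.of (some (y, i))) = FreeGroup.of (some (y, i + j)) := by
  induction j using Int.induction_on with
  | zero => simp
  | succ j ih =>
    rw [add_comm (j : ℤ), zpow_add, zpow_one, MulAut.mul_apply, ih, shift_apply, shiftHom_some]
    congr 3; ring
  | pred j ih =>
    rw [sub_eq_neg_add, zpow_add, zpow_neg_one, MulAut.mul_apply, ih]
    refine (shift h).injective ?_
    rw [MulAut.apply_inv_self, shift_apply, shiftHom_some]
    congr 3; ring

end SurfaceGroup

/-- The fundamental group of the closed oriented surface of genus `h + 1`. -/
abbrev SurfaceGroup (h : ℕ) : Type :=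
  SurfaceGroup.Kernel h ⋊[zpowersHom (MulAut (SurfaceGroup.Kernel h)) (SurfaceGroup.shift h)]
    Multiplicative ℤ

/-! ### Generators, universal property and normal subgroups of the surface group. -/

namespace SurfaceGroup

open SemidirectProduct

/-- The generators `aⱼ`. -/
def genA (h : ℕ) : ℕ → SurfaceGroup h
  | 0 => inl (FreeGroup.of none)
  | j + 1 => inl (kernelGen h false 0 j)

/-- The generators `bⱼ`. -/
def genB (h : ℕ) : ℕ → SurfaceGroup h
  | 0 => inr (Multiplicative.ofAdd 1)
  | j + 1 => inl (kernelGen h true 0 j)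

theorem genB_conj (h : ℕ) (x : Kernel h) :
    genB h 0 * inl x * (genB h 0)⁻¹ = (inl (shiftHom h x) : SurfaceGroup h) := by
  have := inl_aut (φ := zpowersHom (MulAut (Kernel h)) (shift h)) (Multiplicative.ofAdd 1) x
  rw [map_inv] at this
  rw [genB, ← this]
  simp [shift_apply]

theorem surfaceWord_gen (h : ℕ) : surfaceWord (genA h) (genB h) (h + 1) = 1 := by
  rw [surfaceWord_succ', genA, ← map_inv, genB_conj]
  change surfaceWord (fun i => inl (kernelGen h false 0 i)) (fun i => inl (kernelGen h true 0 i)) h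
    * _ = 1
  rw [← map_surfaceWord, ← tail, map_inv, shiftHom_none, ← map_mul, ← map_mul]
  simp

/-- The universal property of the surface group. -/
theorem exists_hom {h : ℕ} {G : Type*} [Group G] (a b : ℕ → G)
    (hab : surfaceWord a b (h + 1) = 1) :
    ∃ f : SurfaceGroup h →* G, (∀ j ≤ h, f (genA h j) = a j) ∧ ∀ j ≤ h, f (genB h j) = b j := by
  let fn : Kernel h →* G := FreeGroup.lift fun x => x.elim (a 0)
    fun y => b 0 ^ y.2 * (if y.1.2 then b (y.1.1 + 1) else a (y.1.1 + 1)) * (b 0 ^ y.2)⁻¹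
  have hgen : ∀ (s : Bool), ∀ j < h, fn (kernelGen h s 0 j) =
      if s then b (j + 1) else a (j + 1) := by
    intro s j hj
    simp [fn, kernelGen, hj]
  have htail : fn (tail h 0) = (b 0 * (a 0)⁻¹ * (b 0)⁻¹ * a 0)⁻¹ := by
    rw [eq_inv_iff_mul_eq_one, ← hab, surfaceWord_succ', tail, map_surfaceWord]
    congr 1
    exact surfaceWord_congr (fun j hj => by simp [hgen _ _ hj]) (fun j hj => by simp [hgen _ _ hj])
  -- Compatibility of `fn` with the action of `b₀`. On the conjugates it is a shift of exponents; on
  -- `a₀` it is exactly the surface relation.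
  have h1 : fn.comp (shift h).toMonoidHom = (MulAut.conj (b 0)).toMonoidHom.comp fn := by
    ext (_ | ⟨y, i⟩)
    · have h2 : fn (FreeGroup.of none) = a 0 := by simp [fn]
      simp only [MonoidHom.comp_apply, MulEquiv.coe_toMonoidHom, shift_apply, shiftHom_none,
        map_mul, htail, h2, MulAut.conj_apply]
      group
    · simp [shift_apply, shiftHom_some, fn]
      rw [add_comm i, zpow_add]
      group
  have h1' : ∀ x, fn (shift h x) = b 0 * fn x * (b 0)⁻¹ := fun x => DFunLike.congr_fun h1 x
  have h2 : ∀ (j : ℤ) (x), fn ((shift h ^ j) x) = b 0 ^ j * fn x * (b 0 ^ j)⁻¹ := by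
    intro j
    induction j using Int.induction_on with
    | zero => simp
    | succ j ih =>
      intro x
      rw [add_comm (j : ℤ), zpow_add, zpow_one, MulAut.mul_apply, h1', ih, zpow_add]
      group
    | pred j ih =>
      intro x
      have h3 := h1' ((shift h ^ (-(j : ℤ) - 1)) x)
      rw [← MulAut.mul_apply, ← zpow_one_add, add_sub_cancel, ih] at h3
      rw [eq_comm, mul_inv_eq_iff_eq_mul, ← eq_inv_mul_iff_mul_eq] at h3
      rw [h3, zpow_sub]
      group
  let f : SurfaceGroup h →* G := SemidirectProduct.lift fn (zpowersHom G (b 0)) (fun g => by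
    ext x
    simpa [← map_zpow] using h2 g.toAdd (FreeGroup.of x))
  refine ⟨f, fun j hj => ?_, fun j hj => ?_⟩
  · cases j with
    | zero => simp [f, genA, fn]
    | succ j => simp [f, genA, hgen false j hj]
  · cases j with
    | zero => simp [f, genB]
    | succ j => simp [f, genB, hgen true j hj]

/-- The free basis of the kernel consists of `a₀` and conjugates by powers of `b₀` of the other
generators. -/
theorem eq_top_of_gen_mem {h : ℕ} (H : Subgroup (SurfaceGroup h))
    (hA : ∀ j ≤ h, genA h j ∈ H) (hB : ∀ j ≤ h, genB h j ∈ H) : H = ⊤ := by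
  have hr : ∀ z : Multiplicative ℤ, (inr z : SurfaceGroup h) ∈ H := by
    intro z
    have := H.zpow_mem (hB 0 (Nat.zero_le _)) z.toAdd
    rw [genB, ← map_zpow, ← ofAdd_zsmul] at this
    simpa using this
  have hl : ∀ x : Kernel h, (inl x : SurfaceGroup h) ∈ H := by
    intro x
    suffices (⊤ : Subgroup (Kernel h)) ≤ H.comap inl from this trivial
    rw [← FreeGroup.closure_range_of, Subgroup.closure_le]
    rintro _ ⟨_ | ⟨⟨j, s⟩, i⟩, rfl⟩
    · exact hA 0 (Nat.zero_le _)
    · have h1 : (inl (kernelGen h s 0 j) : SurfaceGroup h) ∈ H := by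
        cases s
        · exact hA (j + 1) j.2
        · exact hB (j + 1) j.2
      have h2 := inl_aut (φ := zpowersHom (MulAut (Kernel h)) (shift h)) (Multiplicative.ofAdd i)
        (kernelGen h s 0 j)
      have h3 : zpowersHom (MulAut (Kernel h)) (shift h) (Multiplicative.ofAdd i)
        (kernelGen h s 0 j) = FreeGroup.of (some ((j, s), i)) := by
        simp [kernelGen, shift_zpow_some]
      rw [h3] at h2
      rw [SetLike.mem_coe, Subgroup.mem_comap, h2]
      exact H.mul_mem (H.mul_mem (hr _) h1) (hr _)
  refine (Subgroup.eq_top_iff' H).mpr fun x => ?_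
  rw [← inl_left_mul_inr_right x]
  exact H.mul_mem (hl _) (hr _)

/-- A nontrivial normal subgroup of a surface group of genus at least two contains a free group of
rank two. -/
theorem exists_injective_of_normal {h : ℕ} (hh : 1 ≤ h) (K : Subgroup (SurfaceGroup h)) [K.Normal]
    (hK : K ≠ ⊥) :
    ∃ f : FreeGroup (Fin 2) →* SurfaceGroup h, Function.Injective f ∧ ∀ w, f w ∈ K := by
  classical
  let y : Fin h × Bool := (⟨0, hh⟩, false)
  by_cases hN : K.comap (inl : Kernel h →* SurfaceGroup h) = ⊥
  · exfalso
    obtain ⟨⟨⟨n, z⟩, hk⟩, hk1⟩ := Subgroup.ne_bot_iff_exists_ne_one.mp hK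
    have hmem : ∀ x : Kernel h, (inl x : SurfaceGroup h) ∈ K → x = 1 := by
      intro x hx
      have : x ∈ K.comap (inl : Kernel h →* SurfaceGroup h) := hx
      rwa [hN, Subgroup.mem_bot] at this
    have hz : z.toAdd ≠ 0 := by
      intro hz
      obtain rfl : z = 1 := hz
      obtain rfl : n = 1 := hmem n hk
      exact hk1 rfl
    -- The commutator of `(n, z) ∈ K` with the inverse of a basis element of the free part lies in
    -- `K` and in the free part, hence is trivial. It says that the basis elements of index `z ≠ 0`
    -- and of index `0` are conjugate in the free group.
    have hcomm : n * (shift h ^ z.toAdd) (FreeGroup.of (some (y, 0))) * n⁻¹ *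
        (FreeGroup.of (some (y, 0)))⁻¹ = 1 := by
      refine hmem _ ?_
      have h1 := K.mul_mem hk (Subgroup.Normal.conj_mem ‹_› _ (K.inv_mem hk)
        (inl (FreeGroup.of (some (y, 0)))))
      convert h1 using 1
      ext
      · simp [mul_assoc]
      · simp
    rw [shift_zpow_some] at hcomm
    -- Counting the basis element of index `0` refutes the conjugacy.
    let c : Kernel h →* Multiplicative ℤ :=
      FreeGroup.lift fun x => if x = some (y, 0) then .ofAdd 1 else 1
    have h2 := congrArg c hcomm
    simp [c, hz] at h2
  · have : Nontrivial (Option ((Fin h × Bool) × ℤ)) := ⟨none, some (y, 0), by simp⟩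
    obtain ⟨f, hf, hfK⟩ := FreeGroup.exists_injective_of_normal _ hN
    exact ⟨inl.comp f, inl_injective.comp hf, hfK⟩

end SurfaceGroup

/-! ### The kernel of the map induced by the inclusion of a fibre is central -/

section FibreBundle

open Set Topology

/-- Pasting lemma relative to `S`: at a point outside a closed `A`, continuity within `S ∩ A` is
vacuous. -/
theorem ContinuousOn.of_isClosed_cover {X Y : Type*} [TopologicalSpace X] [TopologicalSpace Y]
    {f : X → Y} {S A₁ A₂ : Set X} (h₁ : IsClosed A₁) (h₂ : IsClosed A₂) (hS : S ⊆ A₁ ∪ A₂)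
    (hf₁ : ContinuousOn f (S ∩ A₁)) (hf₂ : ContinuousOn f (S ∩ A₂)) : ContinuousOn f S := by
  have key : ∀ A : Set X, IsClosed A → ContinuousOn f (S ∩ A) → ∀ x ∈ S,
      ContinuousWithinAt f (S ∩ A) x := by
    intro A hA hf x hx
    by_cases hxA : x ∈ A
    · exact hf x ⟨hx, hxA⟩
    · exact continuousWithinAt_of_notMem_closure fun h =>
        hxA (hA.closure_subset_iff.mpr inter_subset_right h)
  intro x hx
  refine ((key A₁ h₁ hf₁ x hx).union (key A₂ h₂ hf₂ x hx)).mono ?_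
  rw [← inter_union_distrib_left]
  exact subset_inter Subset.rfl hS

variable {F X Z : Type*} {B : Type*} [TopologicalSpace F] [TopologicalSpace X] [TopologicalSpace Z]

/-- The pullback of `p : X → B` by `b : Z → B` is homeomorphic over `C ⊆ Z` to `C × F`. -/
def IsTrivialOver (F : Type*) [TopologicalSpace F] (p : X → B) (b : Z → B) (C : Set Z) : Prop :=
  ∃ (Ψ : Z × F → X) (Φ : Z × X → F), ContinuousOn Ψ (C ×ˢ univ) ∧
    ContinuousOn Φ {q | q.1 ∈ C ∧ p q.2 = b q.1} ∧ (∀ z ∈ C, ∀ f, p (Ψ (z, f)) = b z) ∧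
    (∀ z ∈ C, ∀ f, Φ (z, Ψ (z, f)) = f) ∧ ∀ z ∈ C, ∀ x, p x = b z → Ψ (z, Φ (z, x)) = x

theorem IsTrivialOver.mono {p : X → B} {b : Z → B} {C D : Set Z} (h : IsTrivialOver F p b C)
    (hD : D ⊆ C) : IsTrivialOver F p b D := by
  obtain ⟨Ψ, Φ, h1, h2, h3, h4, h5⟩ := h
  exact ⟨Ψ, Φ, h1.mono (prod_mono hD Subset.rfl), h2.mono fun q hq => ⟨hD hq.1, hq.2⟩,
    fun z hz => h3 z (hD hz), fun z hz => h4 z (hD hz), fun z hz => h5 z (hD hz)⟩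

theorem Bundle.Trivialization.isTrivialOver [TopologicalSpace B] {p : X → B}
    (e : Bundle.Trivialization F p) {b : Z → B}
    (hb : Continuous b) {C : Set Z} (hC : C ⊆ b ⁻¹' e.baseSet) : IsTrivialOver F p b C := by
  refine ⟨fun q => e.toOpenPartialHomeomorph.symm (b q.1, q.2), fun q => (e q.2).2, ?_, ?_, ?_, ?_,
    ?_⟩
  · refine e.continuousOn_invFun.comp (by fun_prop) fun q hq => ?_
    rw [e.target_eq]
    exact ⟨hC hq.1, trivial⟩
  · refine continuous_snd.comp_continuousOn (e.continuousOn_toFun.comp continuousOn_snd ?_)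
    intro q hq
    exact e.mem_source.mpr (hq.2 ▸ hC hq.1)
  · exact fun z hz f => e.proj_symm_apply' (hC hz)
  · exact fun z hz f => congrArg Prod.snd (e.apply_symm_apply' (hC hz))
  · intro z hz x hx
    dsimp only
    rw [← hx]
    exact e.symm_apply_mk_proj (e.mem_source.mpr (hx ▸ hC hz))

/-- The map `r` retracts `C₂` onto `C₁ ∩ C₂`. Correcting the second trivialization at `z` by the
change of fibre coordinates at `r z` makes it agree with the first on the intersection, so that the
two can be pasted. -/
theorem IsTrivialOver.union {p : X → B} {b : Z → B} {C₁ C₂ : Set Z} (hC₁ : IsClosed C₁)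
    (hC₂ : IsClosed C₂) (h₁ : IsTrivialOver F p b C₁) (h₂ : IsTrivialOver F p b C₂)
    (r : Z → Z) (hr : Continuous r) (hr₁ : MapsTo r C₂ C₁) (hr₂ : MapsTo r C₂ C₂)
    (hr₃ : ∀ z ∈ C₁ ∩ C₂, r z = z) : IsTrivialOver F p b (C₁ ∪ C₂) := by
  classical
  obtain ⟨Ψ₁, Φ₁, c₁, d₁, l₁, s₁, t₁⟩ := h₁
  obtain ⟨Ψ₂, Φ₂, c₂, d₂, l₂, s₂, t₂⟩ := h₂
  let Ψ' : Z × F → X := fun q => Ψ₂ (q.1, Φ₂ (r q.1, Ψ₁ (r q.1, q.2)))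
  let Φ' : Z × X → F := fun q => Φ₁ (r q.1, Ψ₂ (r q.1, Φ₂ q))
  have hΨ' : ∀ z ∈ C₁ ∩ C₂, ∀ f, Ψ' (z, f) = Ψ₁ (z, f) := fun z hz f => by
    simp only [Ψ', hr₃ z hz]
    exact t₂ z hz.2 _ (l₁ z hz.1 f)
  have hΦ' : ∀ z ∈ C₁ ∩ C₂, ∀ x, p x = b z → Φ' (z, x) = Φ₁ (z, x) := fun z hz x hx => by
    simp only [Φ', hr₃ z hz]
    rw [t₂ z hz.2 _ hx]
  have hcΨ' : ContinuousOn Ψ' (C₂ ×ˢ univ) := by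
    refine c₂.comp (continuousOn_fst.prodMk (d₂.comp
      ((hr.comp continuous_fst).continuousOn.prodMk (c₁.comp (by fun_prop) ?_)) ?_)) ?_
    · exact fun q hq => ⟨hr₁ hq.1, trivial⟩
    · exact fun q hq => ⟨hr₂ hq.1, l₁ _ (hr₁ hq.1) _⟩
    · exact fun q hq => ⟨hq.1, trivial⟩
  have hcΦ' : ContinuousOn Φ' {q | q.1 ∈ C₂ ∧ p q.2 = b q.1} := by
    refine d₁.comp ((hr.comp continuous_fst).continuousOn.prodMk (c₂.comp
      ((hr.comp continuous_fst).continuousOn.prodMk d₂) ?_)) ?_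
    · exact fun q hq => ⟨hr₂ hq.1, trivial⟩
    · exact fun q hq => ⟨hr₁ hq.1, l₂ _ (hr₂ hq.1) _⟩
  refine ⟨fun q => if q.1 ∈ C₁ then Ψ₁ q else Ψ' q, fun q => if q.1 ∈ C₁ then Φ₁ q else Φ' q,
    ?_, ?_, ?_, ?_, ?_⟩
  · refine ContinuousOn.of_isClosed_cover (hC₁.prod isClosed_univ) (hC₂.prod isClosed_univ)
      (union_prod.le) ?_ ?_
    · exact c₁.congr_mono (fun q hq => if_pos hq.2.1) inter_subset_right
    · refine hcΨ'.congr_mono (fun q hq => ?_) inter_subset_right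
      split_ifs with h
      · exact (hΨ' _ ⟨h, hq.2.1⟩ _).symm
      · rfl
  · refine ContinuousOn.of_isClosed_cover (hC₁.prod isClosed_univ) (hC₂.prod isClosed_univ)
      (fun q hq => hq.1.imp (fun h => ⟨h, trivial⟩) (fun h => ⟨h, trivial⟩)) ?_ ?_
    · exact d₁.congr_mono (fun q hq => if_pos hq.2.1) fun q hq => ⟨hq.2.1, hq.1.2⟩
    · refine hcΦ'.congr_mono (fun q hq => ?_) fun q hq => ⟨hq.2.1, hq.1.2⟩
      split_ifs with h
      · exact (hΦ' _ ⟨h, hq.2.1⟩ _ hq.1.2).symm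
      · rfl
  · intro z hz f
    dsimp only
    split_ifs with h
    · exact l₁ z h f
    · exact l₂ z (hz.resolve_left h) _
  · intro z hz f
    dsimp only
    split_ifs with h
    · exact s₁ z h f
    · have h2 := hz.resolve_left h
      simp only [Φ', Ψ', s₂ z h2]
      rw [t₂ _ (hr₂ h2) _ (l₁ _ (hr₁ h2) _), s₁ _ (hr₁ h2)]
  · intro z hz x hx
    dsimp only
    split_ifs with h
    · exact t₁ z h x hx
    · have h2 := hz.resolve_left h
      simp only [Φ', Ψ']
      rw [t₁ _ (hr₁ h2) _ (l₂ _ (hr₂ h2) _), s₂ _ (hr₂ h2), t₂ z h2 x hx]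

variable [TopologicalSpace B]

/-- The pullback of a fibre bundle to a square is trivial. -/
theorem IsFibreBundle.isTrivialOver_square {p : X → B} (hp : IsFibreBundle F p)
    (b : I × I → B) (hb : Continuous b) :
    IsTrivialOver F p b univ := by
  choose T hT using hp
  obtain ⟨t, t_0, t_mono, ⟨N, hN⟩, t_sub⟩ :=
    exists_monotone_Icc_subset_open_cover_unitInterval_prod_self
      (fun y ↦ (T y).open_baseSet.preimage hb) fun z _ ↦ mem_iUnion.2 ⟨b z, hT _⟩
  have hcell : ∀ m n, IsTrivialOver F p b (Icc (t m) (t (m + 1)) ×ˢ Icc (t n) (t (n + 1))) := by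
    intro m n
    obtain ⟨y, hy⟩ := t_sub m n
    exact (T y).isTrivialOver hb hy
  -- Small cells are glued along horizontal sides into columns of width one cell, then the columns
  -- along vertical sides; the retractions project onto the common side.
  have hrow : ∀ m n, IsTrivialOver F p b (Icc (t m) (t (m + 1)) ×ˢ Icc 0 (t n)) := by
    intro m n
    induction n with
    | zero =>
      refine (hcell m 0).mono (prod_mono Subset.rfl ?_)
      rw [t_0]
      exact Icc_subset_Icc le_rfl bot_le
    | succ n ih =>
      refine (ih.union (isClosed_Icc.prod isClosed_Icc) (isClosed_Icc.prod isClosed_Icc)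
        (hcell m n) (fun z => (z.1, t n)) (by fun_prop) ?_ ?_ ?_).mono ?_
      · exact fun z hz => ⟨hz.1, bot_le, le_rfl⟩
      · exact fun z hz => ⟨hz.1, le_rfl, t_mono n.le_succ⟩
      · exact fun z hz => Prod.ext rfl (le_antisymm hz.2.2.1 hz.1.2.2)
      · rw [← prod_union, Icc_union_Icc_eq_Icc (show 0 ≤ t n from bot_le) (t_mono n.le_succ)]
  have hcol : ∀ m, IsTrivialOver F p b (Icc 0 (t m) ×ˢ univ) := by
    have hu : (univ : Set I) = Icc 0 (t N) := by
      rw [hN N le_rfl]; exact (eq_univ_of_forall fun t : I ↦ (⟨bot_le, le_top⟩ : t ∈ Icc 0 1)).symm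
    intro m
    induction m with
    | zero =>
      refine (hrow 0 N).mono (prod_mono ?_ hu.subset)
      rw [t_0]
      exact Icc_subset_Icc le_rfl bot_le
    | succ m ih =>
      refine (ih.union (isClosed_Icc.prod isClosed_univ) (isClosed_Icc.prod isClosed_univ)
        (C₂ := Icc (t m) (t (m + 1)) ×ˢ univ) (by rw [hu]; exact hrow m N)
        (fun z => (t m, z.2)) (by fun_prop) ?_ ?_ ?_).mono ?_
      · exact fun z hz => ⟨⟨bot_le, le_rfl⟩, trivial⟩
      · exact fun z hz => ⟨⟨le_rfl, t_mono m.le_succ⟩, trivial⟩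
      · exact fun z hz => Prod.ext (le_antisymm hz.2.1.1 hz.1.1.2) rfl
      · rw [← union_prod, Icc_union_Icc_eq_Icc (show 0 ≤ t m from bot_le) (t_mono m.le_succ)]
  refine (hcol N).mono fun z _ => ⟨⟨bot_le, ?_⟩, trivial⟩
  rw [hN N le_rfl]
  exact le_top

/-- A loop in a fibre which is null-homotopic in the total space commutes, up to homotopy in the
fibre, with every loop in the fibre. -/
theorem IsFibreBundle.homotopic_trans_comm {p : X → B} (hp : IsFibreBundle F p)
    (hpc : Continuous p) (e : Bundle.Trivialization F p) {b₀ : B} (hb₀ : b₀ ∈ e.baseSet)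
    (i : C(F, X)) (hi : ∀ f, p (i f) = b₀) (hei : ∀ f, (e (i f)).2 = f) {f₀ : F}
    (γ δ : Path f₀ f₀) (hγ : (γ.map i.continuous).Homotopic (Path.refl (i f₀))) :
    (γ.trans δ).Homotopic (δ.trans γ) := by
  obtain ⟨H⟩ := hγ
  obtain ⟨Ψ, Φ, hΨ, hΦ, hl, -, hr⟩ := hp.isTrivialOver_square (fun u => p (H u))
    (hpc.comp H.continuous)
  replace hΨ : Continuous Ψ := by simpa [continuousOn_univ] using hΨ
  -- the part of the square lying over the base point
  let D := {u : I × I // p (H u) = b₀}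
  -- Over `D` the fibre of the pullback is the fibre over `b₀`, so it has two coordinates in `F`:
  -- one from the trivialization over the square, one from `e`. `M` converts the first into the
  -- second.
  let M : C(D × F, F) := ⟨fun q => (e (Ψ (q.1.1, q.2))).2, by
    refine continuous_snd.comp (e.continuousOn_toFun.comp_continuous
      (hΨ.comp ((continuous_subtype_val.comp continuous_fst).prodMk continuous_snd)) fun q => ?_)
    rw [e.mem_source, hl _ trivial]
    change p (H q.1.1) ∈ _
    rw [q.1.2]
    exact hb₀⟩
  -- The coordinate of `H` in the trivialization over the square. It is defined on the whole square,
  -- whereas `M` only makes sense over `D`.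
  let h : C(I × I, F) := ⟨fun u => Φ (u, H u),
    hΦ.comp_continuous (by fun_prop) fun u => ⟨trivial, rfl⟩⟩
  have hM : ∀ u : D, M (u, h u.1) = (e (H u.1)).2 := fun u => by
    change (e (Ψ (u.1, Φ (u.1, H u.1)))).2 = _
    rw [hr _ trivial _ rfl]
  let u₀ : D := ⟨(0, 0), by rw [H.source]; exact hi _⟩
  let u₁ : D := ⟨(0, 1), by rw [H.target]; exact hi _⟩
  let c₀ : Path u₀ u₁ :=
    { toFun := fun t => ⟨(0, t), by rw [H.apply_zero]; exact hi _⟩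
      continuous_toFun := by fun_prop
      source' := rfl
      target' := rfl }
  obtain ⟨c₁, hc₁⟩ : ∃ c : Path u₁ u₀, ∀ t, H (c t).1 = i f₀ := by
    have h1 : JoinedIn {u | H u = i f₀} (0, 1) (1, 1) :=
      ⟨⟨⟨fun t => (t, 1), by fun_prop⟩, rfl, rfl⟩, fun t => H.target t⟩
    have h2 : JoinedIn {u | H u = i f₀} (1, 0) (1, 1) :=
      ⟨⟨⟨fun t => (1, t), by fun_prop⟩, rfl, rfl⟩, fun t => H.apply_one t⟩
    have h3 : JoinedIn {u | H u = i f₀} (0, 0) (1, 0) :=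
      ⟨⟨⟨fun t => (t, 0), by fun_prop⟩, rfl, rfl⟩, fun t => H.source t⟩
    obtain ⟨c, hc⟩ := (h1.trans h2.symm).trans h3.symm
    exact ⟨⟨⟨fun t => ⟨c t, by rw [hc t]; exact hi _⟩, by fun_prop⟩,
      Subtype.ext c.source, Subtype.ext c.target⟩, hc⟩
  -- The boundary of the square: `H` runs through `γ` on the side `c₀` and is constant on the three
  -- sides that make up `c₁`.
  obtain ⟨ω, hωdef⟩ : ∃ ω : Path u₀ u₀, ω = c₀.trans c₁ := ⟨_, rfl⟩
  let v : C(D, F) := h.comp ⟨Subtype.val, continuous_subtype_val⟩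
  -- The loop `ω` need not contract in `D`, but its image under `h` contracts through the square.
  have hω : (ω.map v.continuous).Homotopic (Path.refl (v u₀)) := by
    have : ContractibleSpace I := (convex_Icc (0 : ℝ) 1).contractibleSpace ⟨0, by simp⟩
    have : (ω.map continuous_subtype_val).Homotopic (Path.refl u₀.1) :=
      SimplyConnectedSpace.paths_homotopic _ _
    exact this.map h
  let k : C(F, F) := ⟨fun f => Φ ((0, 0), i f),
    hΦ.comp_continuous (by fun_prop) fun f => ⟨trivial, by
      change p (i f) = p (H ((0 : I), (0 : I)))
      rw [H.source, hi]; exact (hi f₀).symm⟩⟩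
  have hk0 : v u₀ = k f₀ := by
    change Φ ((0, 0), H ((0 : I), (0 : I))) = Φ ((0, 0), i f₀)
    rw [H.source]
  have hMk : ∀ f, M (u₀, k f) = f := fun f => by
    change (e (Ψ ((0, 0), Φ ((0, 0), i f)))).2 = f
    rw [hr _ trivial _ ?_, hei]
    change p (i f) = p (H ((0 : I), (0 : I)))
    rw [H.source, hi]; exact (hi f₀).symm
  let δ' : Path (v u₀) (v u₀) := (δ.map k.continuous).cast hk0 hk0
  have hbase : f₀ = M (u₀, v u₀) := by rw [hk0, hMk]
  -- As `h ∘ ω` is null-homotopic, the first loop is homotopic to `ω` in the factor `D` alone, and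
  -- loops in different factors of `D × F` commute. `M` maps the two loops to `γ`, up to a constant
  -- path, and to `δ`.
  have hcomm : ((ω.prod (ω.map v.continuous)).trans ((Path.refl u₀).prod δ')).Homotopic
      (((Path.refl u₀).prod δ').trans (ω.prod (ω.map v.continuous))) := by
    rw [← Path.Homotopic.Quotient.eq, Path.Homotopic.Quotient.mk_trans,
      Path.Homotopic.Quotient.mk_trans]
    have e1 : Path.Homotopic.Quotient.mk (ω.prod (ω.map v.continuous)) =
        Path.Homotopic.prod (.mk ω) (.refl _) := by
      rw [← Path.Homotopic.Quotient.mk_refl, ← Path.Homotopic.Quotient.eq.mpr hω]; rfl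
    have e2 : Path.Homotopic.Quotient.mk ((Path.refl u₀).prod δ') =
        Path.Homotopic.prod (.refl _) (.mk δ') := rfl
    rw [e1, e2, Path.Homotopic.comp_prod_eq_prod_comp, Path.Homotopic.comp_prod_eq_prod_comp]
    simp
  have hcomm' := (hcomm.map M).pathCast hbase hbase
  have e1 : ((ω.prod (ω.map v.continuous)).map M.continuous).cast hbase hbase =
      γ.trans (Path.refl f₀) := by
    ext t
    change M (ω t, h (ω t).1) = _
    rw [hM]
    simp only [hωdef, Path.trans_apply]
    split_ifs with ht
    · change (e (H (0, _))).2 = _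
      rw [H.apply_zero]
      exact hei _
    · rw [hc₁, hei]; rfl
  have e2 : (((Path.refl u₀).prod δ').map M.continuous).cast hbase hbase = δ := by
    ext t
    exact hMk _
  rw [Path.map_trans, Path.map_trans] at hcomm'
  have e3 : ∀ a b : Path (M (u₀, v u₀)) (M (u₀, v u₀)), (a.trans b).cast hbase hbase =
      (a.cast hbase hbase).trans (b.cast hbase hbase) := fun a b => rfl
  rw [e3, e3, e1, e2] at hcomm'
  have e4 : (γ.trans (Path.refl f₀)).Homotopic γ := ⟨Path.Homotopy.transRefl γ⟩
  exact (e4.symm.hcomp (.refl δ)).trans (hcomm'.trans ((Path.Homotopic.refl δ).hcomp e4))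

end FibreBundle

/-! ### Generators of the fundamental group of a quotient of a simply connected space -/

section BasedPath

open Set Topology

variable {S : Type*} [TopologicalSpace S] {x₀ : S}

/-- Homotopy classes of paths starting at `x₀`: the points of the universal cover. -/
abbrev BasedPath (x₀ : S) : Type _ := Σ x : S, Path.Homotopic.Quotient x₀ x

namespace BasedPath

/-- Extend a based path by a path. -/
noncomputable abbrev append (p : BasedPath x₀) {y : S} (γ : Path.Homotopic.Quotient p.1 y) :
    BasedPath x₀ :=
  ⟨y, p.2.trans γ⟩

/-- Precompose a based path with a loop. -/
noncomputable abbrev precomp (k : FundamentalGroup S x₀) (p : BasedPath x₀) : BasedPath x₀ :=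
  ⟨p.1, Path.Homotopic.Quotient.trans k p.2⟩

/-- Extend a based path by a path given as a continuous map. -/
noncomputable abbrev extend (p : BasedPath x₀) (γ : C(I, S)) (h : γ 0 = p.1) : BasedPath x₀ :=
  ⟨γ 1, p.2.trans (.mk ⟨γ, h, rfl⟩)⟩

theorem append_precomp (k : FundamentalGroup S x₀) (p : BasedPath x₀) {y : S}
    (γ : Path.Homotopic.Quotient p.1 y) :
    append (precomp k p) γ = precomp k (append p γ) := by
  simp only [append, precomp, Path.Homotopic.Quotient.trans_assoc]

/-- The product `l * k` is the concatenation of `k` followed by `l`, whence the reversed order. -/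
theorem precomp_precomp (k l : FundamentalGroup S x₀) (p : BasedPath x₀) :
    precomp k (precomp l p) = precomp (l * k) p := by
  simp only [precomp, FundamentalGroup.mul_def, Path.Homotopic.Quotient.trans_assoc]

theorem precomp_one (p : BasedPath x₀) : precomp 1 p = p := by
  simp only [precomp, FundamentalGroup.one_def, Path.Homotopic.Quotient.refl_trans]

theorem eq_precomp_inv {k : FundamentalGroup S x₀} {p q : BasedPath x₀} (h : p = precomp k q) :
    q = precomp k⁻¹ p := by
  rw [h, precomp_precomp, mul_inv_cancel, precomp_one]

/-- The fundamental group acts freely on the universal cover. -/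
theorem precomp_injective (p : BasedPath x₀) :
    Function.Injective fun k : FundamentalGroup S x₀ => precomp k p := by
  intro k l h
  have h1 : Path.Homotopic.Quotient.trans k p.2 = Path.Homotopic.Quotient.trans l p.2 :=
    eq_of_heq (Sigma.mk.inj h).2
  have h2 := congrArg (fun c => Path.Homotopic.Quotient.trans c p.2.symm) h1
  simpa only [Path.Homotopic.Quotient.trans_assoc, Path.Homotopic.Quotient.trans_symm,
    Path.Homotopic.Quotient.trans_refl] using h2

theorem append_mk_eq_extend (p : BasedPath x₀) {y : S} (γ : Path p.1 y) :
    append p (.mk γ) = extend p γ.toContinuousMap γ.source := by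
  rcases γ with ⟨γ, h0, rfl⟩
  rfl

theorem extend_precomp (k : FundamentalGroup S x₀) (p : BasedPath x₀) (γ : C(I, S))
    (h : γ 0 = p.1) : extend (precomp k p) γ h = precomp k (extend p γ h) :=
  append_precomp k p _

theorem extend_congr {p q : BasedPath x₀} {γ δ : C(I, S)} (hpq : p = q) (hγδ : γ = δ)
    (h : γ 0 = p.1) : extend p γ h = extend q δ (hγδ ▸ hpq ▸ h) := by
  subst hpq hγδ
  rfl

theorem extend_const (p : BasedPath x₀) (γ : C(I, S)) (h : ∀ t, γ t = p.1) :
    extend p γ (h 0) = p := by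
  obtain ⟨x, a⟩ := p
  obtain rfl : γ = ContinuousMap.const I x := ContinuousMap.ext h
  have : (Path.Homotopic.Quotient.mk ⟨ContinuousMap.const I x, rfl, rfl⟩ :
    Path.Homotopic.Quotient x x) = .refl x := rfl
  change (⟨x, a.trans (.mk ⟨ContinuousMap.const I x, rfl, rfl⟩)⟩ : BasedPath x₀) = ⟨x, a⟩
  rw [this, Path.Homotopic.Quotient.trans_refl]

theorem extend_injective {p q : BasedPath x₀} (γ : C(I, S)) (hp : γ 0 = p.1) (hq : γ 0 = q.1)
    (h : extend p γ hp = extend q γ hq) : p = q := by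
  obtain ⟨x, a⟩ := p
  obtain ⟨y, b⟩ := q
  obtain rfl : x = y := hp.symm.trans hq
  have h1 : a.trans (.mk ⟨γ, hp, rfl⟩) = b.trans (.mk ⟨γ, hp, rfl⟩) := eq_of_heq (Sigma.mk.inj h).2
  have h2 := congrArg (fun c => c.trans (Path.Homotopic.Quotient.mk ⟨γ, hp, rfl⟩).symm) h1
  simp only [Path.Homotopic.Quotient.trans_assoc, Path.Homotopic.Quotient.trans_symm,
    Path.Homotopic.Quotient.trans_refl] at h2
  rw [h2]

/-- The two ways around a square are homotopic. -/
theorem extend_square (K : C(I × I, S)) (p : BasedPath x₀) (h : K (0, 0) = p.1) :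
    extend (extend p (K.comp ⟨fun s => (s, 0), by fun_prop⟩) h)
      (K.comp ⟨fun t => (1, t), by fun_prop⟩) rfl =
    extend (extend p (K.comp ⟨fun t => (0, t), by fun_prop⟩) h)
      (K.comp ⟨fun s => (s, 1), by fun_prop⟩) rfl := by
  obtain ⟨x, a⟩ := p
  obtain rfl : K (0, 0) = x := h
  have : ContractibleSpace I := (convex_Icc (0 : ℝ) 1).contractibleSpace ⟨0, by simp⟩
  let b : Path ((0, 0) : I × I) (1, 0) := ⟨⟨fun s => (s, 0), by fun_prop⟩, rfl, rfl⟩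
  let r : Path ((1, 0) : I × I) (1, 1) := ⟨⟨fun t => (1, t), by fun_prop⟩, rfl, rfl⟩
  let l : Path ((0, 0) : I × I) (0, 1) := ⟨⟨fun t => (0, t), by fun_prop⟩, rfl, rfl⟩
  let u : Path ((0, 1) : I × I) (1, 1) := ⟨⟨fun s => (s, 1), by fun_prop⟩, rfl, rfl⟩
  have h1 : (b.trans r).Homotopic (l.trans u) := SimplyConnectedSpace.paths_homotopic _ _
  have h2 := Path.Homotopic.Quotient.eq.mpr (h1.map K)
  rw [Path.map_trans, Path.map_trans, Path.Homotopic.Quotient.mk_trans,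
    Path.Homotopic.Quotient.mk_trans] at h2
  have h3 := congrArg (fun c => (⟨K (1, 1), a.trans c⟩ : BasedPath (S := S) x₀)) h2
  simp only [← Path.Homotopic.Quotient.trans_assoc] at h3
  exact h3

end BasedPath

/-! ### Lifting a simply connected space to the universal cover of its quotient. -/

namespace SimplyConnectedQuotient

open BasedPath

variable {W : Type*} [TopologicalSpace W] [SimplyConnectedSpace W] (P : C(W, S)) (z₀ : W)

/-- The lift of a point of `W` to the universal cover of `S`. -/
noncomputable abbrev lift (z : W) : BasedPath (P z₀) :=
  ⟨P z, (Path.Homotopic.Quotient.mk (PathConnectedSpace.somePath z₀ z)).map P⟩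

/-- As `W` is simply connected, the path chosen in the definition of `lift` is immaterial. -/
theorem append_lift {z w : W} (δ : Path z w) :
    append (lift P z₀ z) (.mk (δ.map P.continuous)) = lift P z₀ w := by
  refine congrArg (Sigma.mk (P w)) ?_
  change ((Path.Homotopic.Quotient.mk (PathConnectedSpace.somePath z₀ z)).map P).trans
    (.mk (δ.map P.continuous)) = _
  rw [← Path.Homotopic.Quotient.mk_map,
    ← Path.Homotopic.Quotient.mk_trans, ← Path.map_trans, Path.Homotopic.Quotient.mk_map]
  congr 1
  exact Subsingleton.elim _ _

theorem extend_lift {z w : W} (δ : Path z w) (γ : C(I, S)) (h : ∀ t, γ t = P (δ t)) :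
    extend (lift P z₀ z) γ ((h 0).trans (congrArg P δ.source)) = lift P z₀ w := by
  obtain rfl : γ = (δ.map P.continuous).toContinuousMap := ContinuousMap.ext h
  rw [← append_lift P z₀ δ, append_mk_eq_extend]

theorem lift_base : lift P z₀ z₀ = ⟨P z₀, .refl _⟩ := by
  refine congrArg (Sigma.mk (P z₀)) ?_
  rw [Subsingleton.elim (Path.Homotopic.Quotient.mk (PathConnectedSpace.somePath z₀ z₀)) (.refl z₀)]
  rfl

/-- Two points of `W` that move with the same image in `S` keep the same deck transformation between
their lifts. -/
theorem lift_eq_precomp_of_path {z z' w w' : W} {k : FundamentalGroup S (P z₀)}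
    (h : lift P z₀ z = precomp k (lift P z₀ w)) (δ : Path z z') (ε : Path w w')
    (hδε : ∀ t, P (δ t) = P (ε t)) : lift P z₀ z' = precomp k (lift P z₀ w') := by
  rw [← extend_lift P z₀ δ (P.comp δ.toContinuousMap) fun t => rfl,
    ← extend_lift P z₀ ε (P.comp δ.toContinuousMap) hδε, ← extend_precomp]
  exact extend_congr h rfl _

theorem exists_lift_eq_precomp {z w : W} (h : P z = P w) :
    ∃ k : FundamentalGroup S (P z₀), lift P z₀ z = precomp k (lift P z₀ w) := by
  obtain ⟨a, ha⟩ : ∃ a, lift P z₀ z = ⟨P w, a⟩ := ⟨(lift P z₀ z).2.cast rfl h.symm, by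
    refine Sigma.ext h ?_
    exact (Path.Homotopic.Quotient.cast_heq _ _).symm⟩
  refine ⟨a.trans (lift P z₀ w).2.symm, ?_⟩
  rw [ha]
  refine congrArg (Sigma.mk (P w)) ?_
  change a = (a.trans (lift P z₀ w).2.symm).trans (lift P z₀ w).2
  rw [Path.Homotopic.Quotient.trans_assoc, Path.Homotopic.Quotient.symm_trans,
    Path.Homotopic.Quotient.trans_refl]

/-- A saturated open subset of `W` together with a deformation of `W` that exhibits the inclusion
of its image in `S` as null-homotopic. -/
def IsNullChart {W S : Type*} [TopologicalSpace W] (P : W → S) (A : Set W) : Prop :=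
  IsOpen A ∧ ∃ (h : W × I → W) (c : S), ContinuousOn h (A ×ˢ univ) ∧ (∀ z ∈ A, h (z, 0) = z) ∧
    (∀ z ∈ A, P (h (z, 1)) = c) ∧
    ∀ z w, P z = P w → z ∈ A → w ∈ A ∧ ∀ t, P (h (z, t)) = P (h (w, t))

variable {P z₀} {H : Subgroup (FundamentalGroup S (P z₀))}

/-- The deformation of `A` descends to a contraction of `P '' A` in `S`, and following `γ` through
it gives a square. Its vertical sides are images of tracks in `W` and its top is constant, so going
along `γ` amounts to following one track up and another track down. The tracks end at points with
equal image, where the hypothesis on `H` applies. -/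
theorem extend_mem_of_isNullChart (hP : IsQuotientMap P)
    (hH : ∀ z w, P z = P w → ∃ k ∈ H, lift P z₀ z = precomp k (lift P z₀ w))
    {A : Set W} (hA : IsNullChart P A) {p : BasedPath (P z₀)}
    (hp : ∃ k ∈ H, ∃ z, p = precomp k (lift P z₀ z)) (γ : C(I, S)) (hγ : γ 0 = p.1)
    (hγA : ∀ t, γ t ∈ P '' A) : ∃ k ∈ H, ∃ z, extend p γ hγ = precomp k (lift P z₀ z) := by
  obtain ⟨hAo, h, c, hc, h0, h1, hsat⟩ := hA
  have hpre : P ⁻¹' (P '' A) = A := by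
    refine subset_antisymm ?_ (subset_preimage_image P A)
    rintro w ⟨z, hz, hzw⟩
    exact (hsat z w hzw hz).1
  have hU : IsOpen (P '' A) := by rw [← hP.isOpen_preimage, hpre]; exact hAo
  choose rep hrepA hrep using fun u : P '' A => u.2
  let g : (P '' A : Set S) × I → S := fun q => P (h (rep q.1, q.2))
  -- The product of the restricted quotient map with the locally compact space `I` is still a
  -- quotient map; saturation makes the choice of `rep` harmless.
  have hg : Continuous g := by
    refine (hP.restrictPreimage_isOpen hU).continuous_lift_prod_left ?_
    have h2 : ∀ q : (P ⁻¹' (P '' A) : Set W) × I,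
        g ((P '' A).restrictPreimage P q.1, q.2) = P (h (q.1.1, q.2)) := fun q =>
      (hsat _ _ (hrep ⟨P q.1.1, q.1.2⟩) (hrepA _)).2 q.2
    simp_rw [h2]
    exact P.continuous.comp (hc.comp_continuous (by fun_prop) fun q =>
      ⟨hpre.subset q.1.2, trivial⟩)
  have hgP : ∀ z (hz : z ∈ A) t, g (⟨P z, mem_image_of_mem P hz⟩, t) = P (h (z, t)) :=
    fun z hz t => (hsat _ _ (hrep ⟨P z, mem_image_of_mem P hz⟩) (hrepA _)).2 t
  let K : C(I × I, S) := ⟨fun q => g (⟨γ q.1, hγA q.1⟩, q.2), by fun_prop⟩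
  have hK : ∀ s t z, z ∈ A → P z = γ s → K (s, t) = P (h (z, t)) := by
    intro s t z hz hzs
    rw [← hgP z hz t]
    exact congrArg g (Prod.ext (Subtype.ext hzs.symm) rfl)
  obtain ⟨k, hk, z, rfl⟩ := hp
  have hzγ : P z = γ 0 := hγ.symm
  have hz : z ∈ A := by
    rw [← hpre, mem_preimage, hzγ]; exact hγA 0
  obtain ⟨w, hw, hwγ⟩ := hγA 1
  let track : ∀ z ∈ A, Path z (h (z, 1)) := fun z hz =>
    ⟨⟨fun t => h (z, t), hc.comp_continuous (by fun_prop) fun t => ⟨hz, trivial⟩⟩, h0 z hz, rfl⟩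
  have hK0 : ∀ s, K (s, 0) = γ s := fun s => by
    obtain ⟨v, hv, hvs⟩ := hγA s
    rw [hK s 0 v hv hvs, h0 v hv, hvs]
  have hK1 : ∀ s, K (s, 1) = P (h (z, 1)) := fun s => by
    obtain ⟨v, hv, hvs⟩ := hγA s
    rw [hK s 1 v hv hvs, h1 v hv, h1 z hz]
  have hsq := extend_square K (precomp k (lift P z₀ z)) ((hK0 0).trans hγ)
  have hl : extend (precomp k (lift P z₀ z)) (K.comp ⟨fun t => (0, t), by fun_prop⟩)
      ((hK0 0).trans hγ) = precomp k (lift P z₀ (h (z, 1))) :=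
    (extend_precomp k _ _ _).trans (congrArg (precomp k) (extend_lift P z₀ (track z hz) _
      fun t => hK 0 t z hz hzγ))
  replace hsq := (hsq.trans (extend_congr hl rfl _)).trans (extend_const _ _ hK1)
  obtain ⟨k', hk', hkk'⟩ := hH (h (z, 1)) (h (w, 1)) ((h1 z hz).trans (h1 w hw).symm)
  refine ⟨k' * k, H.mul_mem hk' hk, w, ?_⟩
  have h3 : extend (precomp k (lift P z₀ z)) (K.comp ⟨fun s => (s, 0), by fun_prop⟩)
      ((hK0 0).trans hγ) = extend (precomp k (lift P z₀ z)) γ hγ :=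
    extend_congr rfl (ContinuousMap.ext hK0) _
  rw [← h3]
  refine extend_injective (K.comp ⟨fun t => (1, t), by fun_prop⟩) rfl
    (hK 1 0 w hw hwγ |>.trans (congrArg P (h0 w hw))) ?_
  rw [hsq, hkk', precomp_precomp, ← extend_lift P z₀ (track w hw)
    (K.comp ⟨fun t => (1, t), by fun_prop⟩) (fun t => hK 1 t w hw hwγ), ← extend_precomp]

/-- Subdivide the path so that each piece lies in the image of one chart, and apply the previous
lemma piece by piece. -/
theorem mk_subpath_mem_of_isNullChart (hP : IsQuotientMap P)
    (hH : ∀ z w, P z = P w → ∃ k ∈ H, lift P z₀ z = precomp k (lift P z₀ w))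
    (hA : ∀ z, ∃ A, z ∈ A ∧ IsNullChart P A) {x y : S} (γ : Path x y)
    (a : Path.Homotopic.Quotient (P z₀) (γ 0))
    (ha : ∃ k ∈ H, ∃ z, (⟨γ 0, a⟩ : BasedPath (P z₀)) = precomp k (lift P z₀ z)) :
    ∃ k ∈ H, ∃ z, (⟨γ 1, a.trans (.mk (γ.subpath 0 1))⟩ : BasedPath (P z₀)) =
      precomp k (lift P z₀ z) := by
  choose A hzA hA using hA
  choose rep hrep using hP.surjective
  have hopen : ∀ x : S, IsOpen (P '' A (rep x)) := fun x => by
    rw [← hP.isOpen_preimage]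
    have : P ⁻¹' (P '' A (rep x)) = A (rep x) := by
      refine subset_antisymm ?_ (subset_preimage_image P _)
      rintro w ⟨z, hz, hzw⟩
      obtain ⟨-, h, c, -, -, -, hsat⟩ := hA (rep x)
      exact (hsat z w hzw hz).1
    rw [this]
    exact (hA (rep x)).1
  obtain ⟨t, t_0, t_mono, ⟨N, hN⟩, t_sub⟩ :=
    exists_monotone_Icc_subset_open_cover_unitInterval
      (fun x ↦ (hopen x).preimage γ.continuous)
      fun s _ ↦ mem_iUnion.2 ⟨γ s, rep (γ s), hzA _, hrep _⟩
  suffices key : ∀ n, ∃ k ∈ H, ∃ z, (⟨γ (t n), a.trans (.mk (γ.subpath 0 (t n)))⟩ :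
      BasedPath (P z₀)) = precomp k (lift P z₀ z) by
    have := key N
    rwa [hN N le_rfl] at this
  intro n
  induction n with
  | zero =>
    rwa [t_0, Path.subpath_self, Path.Homotopic.Quotient.mk_refl,
      Path.Homotopic.Quotient.trans_refl]
  | succ n ih =>
    obtain ⟨x, hx⟩ := t_sub n
    obtain ⟨k, hk, z, h2⟩ := extend_mem_of_isNullChart hP hH (hA (rep x)) ih
      (γ.subpath (t n) (t (n + 1))).toContinuousMap (γ.subpath _ _).source (fun s => by
        have h2 : (γ.subpath (t n) (t (n + 1))) s ∈ range (γ.subpath (t n) (t (n + 1))) :=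
          mem_range_self s
        rw [Path.range_subpath_of_le _ _ _ (t_mono n.le_succ)] at h2
        obtain ⟨r, hr, hrs⟩ := h2
        exact hrs ▸ hx hr)
    refine ⟨k, hk, z, ?_⟩
    rw [← h2, ← append_mk_eq_extend]
    dsimp only [append]
    rw [Path.Homotopic.Quotient.trans_assoc, ← Path.Homotopic.Quotient.mk_trans,
      Path.Homotopic.Quotient.eq.mpr ⟨Path.Homotopy.subpathTransSubpath γ 0 (t n) _⟩]

/-- If `S` is covered by images of null charts, a subgroup of the fundamental group which accounts
for all the identifications made by `P` is the whole group. -/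
theorem eq_top_of_isNullChart (hP : IsQuotientMap P)
    (hH : ∀ z w, P z = P w → ∃ k ∈ H, lift P z₀ z = precomp k (lift P z₀ w))
    (hA : ∀ z, ∃ A, z ∈ A ∧ IsNullChart P A) : H = ⊤ := by
  refine (Subgroup.eq_top_iff' H).mpr fun c => ?_
  obtain ⟨γ, rfl⟩ := Path.Homotopic.Quotient.mk_surjective c
  have hcast : ∀ {x y u v : S} (hs : u = x) (ht : v = y) (a : Path.Homotopic.Quotient (P z₀) x)
      (c : Path.Homotopic.Quotient x y),
      (⟨v, (a.cast rfl hs).trans (c.cast hs ht)⟩ : BasedPath (P z₀)) = ⟨y, a.trans c⟩ := by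
    rintro _ _ _ _ rfl rfl a c
    rw [Path.Homotopic.Quotient.cast_rfl_rfl, Path.Homotopic.Quotient.cast_rfl_rfl]
  have hcast' : ∀ {x u : S} (hs : u = x) (a : Path.Homotopic.Quotient (P z₀) x),
      (⟨u, a.cast rfl hs⟩ : BasedPath (P z₀)) = ⟨x, a⟩ := by
    rintro _ _ rfl a
    rw [Path.Homotopic.Quotient.cast_rfl_rfl]
  obtain ⟨k, hk, z, h1⟩ := mk_subpath_mem_of_isNullChart hP hH hA γ
    ((Path.Homotopic.Quotient.refl (P z₀)).cast rfl γ.source) ⟨1, H.one_mem, z₀, by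
      rw [precomp_one, lift_base]
      exact hcast' _ _⟩
  rw [Path.subpath_zero_one, Path.Homotopic.Quotient.mk_cast, hcast,
    Path.Homotopic.Quotient.refl_trans] at h1
  obtain ⟨k', hk', h3⟩ := hH z z₀ (congrArg Sigma.fst h1).symm
  have h2 : (⟨P z₀, .mk γ⟩ : BasedPath (P z₀)) =
      precomp (Path.Homotopic.Quotient.mk γ) (lift P z₀ z₀) := by
    rw [lift_base]
    dsimp only [precomp]
    rw [Path.Homotopic.Quotient.trans_refl]
  -- The loop, as a point over the base point, is a translate by `H` of the base lift; freeness of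
  -- the action puts the loop itself in `H`.
  rw [h2, h3, precomp_precomp] at h1
  have h4 := precomp_injective _ h1
  exact h4 ▸ H.mul_mem hk' hk

end SimplyConnectedQuotient

end BasedPath

/-! ### Coverings defined by locally constant potentials -/

namespace SimplyConnectedQuotient

open Set Topology BasedPath

universe u v

variable {S : Type u} {W : Type*} [TopologicalSpace S] [TopologicalSpace W]
  {P : C(W, S)} {ι : Type*} {Γ : Type v} [Group Γ]

/-- The principal bundle over `S` with discrete structure group `Γ` whose transition functions are
the quotients of the locally constant potentials `F i` on the saturated open subsets `A i`
of `W`. -/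
noncomputable def potentialBundle [TopologicalSpace Γ] [DiscreteTopology Γ] (hP : IsQuotientMap P)
    (A : ι → Set W) (hAo : ∀ i, IsOpen (A i)) (hA : ∀ z, ∃ i, z ∈ A i)
    (hsat : ∀ i z w, P z = P w → z ∈ A i → w ∈ A i) (F : ι → W → Γ)
    (hF : ∀ i, ∀ z ∈ A i, ∀ᶠ w in 𝓝 z, F i w = F i z)
    (hinv : ∀ i j z w, P z = P w → z ∈ A i → z ∈ A j →
      (F j z)⁻¹ * F i z = (F j w)⁻¹ * F i w) : FiberBundleCore ι S Γ where
  baseSet i := {x | Function.surjInv hP.surjective x ∈ A i}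
  isOpen_baseSet i := by
    rw [← hP.isOpen_preimage]
    convert! hAo i using 1
    ext z
    exact ⟨hsat i _ _ (Function.surjInv_eq hP.surjective _),
      hsat i _ _ (Function.surjInv_eq hP.surjective _).symm⟩
  indexAt x := (hA (Function.surjInv hP.surjective x)).choose
  mem_baseSet_at x := (hA (Function.surjInv hP.surjective x)).choose_spec
  coordChange i j x v :=
    (F j (Function.surjInv hP.surjective x))⁻¹ * F i (Function.surjInv hP.surjective x) * v
  coordChange_self i x _ v := by simp
  continuousOn_coordChange i j := by
    let c : S → Γ := fun x =>
      (F j (Function.surjInv hP.surjective x))⁻¹ * F i (Function.surjInv hP.surjective x)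
    rintro ⟨x, v⟩ ⟨⟨hi, hj⟩, -⟩
    refine ContinuousAt.continuousWithinAt ?_
    -- The potentials do not descend to `S`, but their quotients do by `hinv`; a level set `V` of
    -- the quotient is open and saturated, so its image is open.
    have hc : ∀ᶠ y in 𝓝 x, c y = c x := by
      let V : Set W := {z | z ∈ A i ∩ A j ∧ (F j z)⁻¹ * F i z = c x}
      have hV : P ⁻¹' (P '' V) = V := by
        refine subset_antisymm ?_ (subset_preimage_image P V)
        rintro w ⟨z, ⟨⟨hzi, hzj⟩, hz⟩, hzw⟩
        exact ⟨⟨hsat i _ _ hzw hzi, hsat j _ _ hzw hzj⟩, (hinv i j z w hzw hzi hzj).symm.trans hz⟩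
      have hVo : IsOpen V := by
        rw [isOpen_iff_eventually]
        rintro z ⟨⟨hzi, hzj⟩, hz⟩
        filter_upwards [hF i z hzi, hF j z hzj, (hAo i).mem_nhds hzi, (hAo j).mem_nhds hzj]
          with w h1 h2 h3 h4
        exact ⟨⟨h3, h4⟩, by rw [h1, h2, hz]⟩
      have hxV : x ∈ P '' V := ⟨_, ⟨⟨hi, hj⟩, rfl⟩, Function.surjInv_eq hP.surjective x⟩
      filter_upwards [(hP.isOpen_preimage.mp (hV.symm ▸ hVo)).mem_nhds hxV] with y hy
      obtain ⟨z, ⟨⟨hzi, hzj⟩, hz⟩, hzy⟩ := hy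
      rw [← hz]
      exact (hinv i j z _ (hzy.trans (Function.surjInv_eq hP.surjective y).symm) hzi hzj).symm
    have h1 : (fun p : S × Γ => c x * p.2) =ᶠ[𝓝 (x, v)] fun p => c p.1 * p.2 := by
      filter_upwards [continuousAt_fst.eventually hc] with p hp
      rw [hp]
    refine ContinuousAt.congr ?_ h1
    exact (continuous_of_discreteTopology.comp continuous_snd).continuousAt
  coordChange_comp i j k x _ v := by simp [mul_assoc]

/-- Locally constant potentials define a permutation representation of the fundamental group in
which the identifications made by `P` act through the differences of potential. -/
theorem exists_monodromy [SimplyConnectedSpace W] (z₀ : W) (hP : IsQuotientMap P)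
    (A : ι → Set W) (hAo : ∀ i, IsOpen (A i)) (hA : ∀ z, ∃ i, z ∈ A i)
    (hsat : ∀ i z w, P z = P w → z ∈ A i → w ∈ A i) (F : ι → W → Γ)
    (hF : ∀ i, ∀ z ∈ A i, ∀ᶠ w in 𝓝 z, F i w = F i z)
    (hinv : ∀ i j z w, P z = P w → z ∈ A i → z ∈ A j →
      (F j z)⁻¹ * F i z = (F j w)⁻¹ * F i w) :
    ∃ (Y : Type (max u v)) (mon : FundamentalGroup S (P z₀) →* Equiv.Perm Y) (y : Γ → Y),
      Function.Injective y ∧ ∀ i k z w, z ∈ A i → w ∈ A i →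
        lift P z₀ z = precomp k (lift P z₀ w) →
          ∀ γ, mon k (y γ) = y (F i w * (F i z)⁻¹ * γ) := by
  let _ : TopologicalSpace Γ := ⊥
  have : DiscreteTopology Γ := ⟨rfl⟩
  let Z := potentialBundle hP A hAo hA hsat F hF hinv
  have cov : IsCoveringMap Z.proj :=
    IsFiberBundle.isCoveringMap fun x => ⟨Z.localTriv (Z.indexAt x), Z.mem_baseSet_at x⟩
  have hbase : ∀ i z, z ∈ A i → P z ∈ Z.baseSet i := fun i z hz =>
    hsat i _ _ (Function.surjInv_eq hP.surjective _).symm hz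
  have hbase' : ∀ i z, P z ∈ Z.baseSet i → z ∈ A i := fun i z hz =>
    hsat i _ _ (Function.surjInv_eq hP.surjective _) hz
  -- A lift of `P` to the total space. In chart `i` its fibre coordinate is `(F i z)⁻¹ * γ`, and the
  -- transition functions are designed so that these expressions match.
  let L : Γ → W → Z.TotalSpace := fun γ z => ⟨P z, (F (Z.indexAt (P z)) z)⁻¹ * γ⟩
  have hL : ∀ γ i z, z ∈ A i →
      L γ z = (Z.localTriv i).toOpenPartialHomeomorph.symm (P z, (F i z)⁻¹ * γ) := by
    intro γ i z hz
    rw [FiberBundleCore.localTriv_symm_apply]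
    refine congrArg (Bundle.TotalSpace.mk (P z)) ?_
    have h1 := hinv i (Z.indexAt (P z)) z _ (Function.surjInv_eq hP.surjective (P z)).symm hz
      (hbase' _ _ (Z.mem_baseSet_at _))
    change _ = (F (Z.indexAt (P z)) (Function.surjInv hP.surjective (P z)))⁻¹ *
      F i (Function.surjInv hP.surjective (P z)) * ((F i z)⁻¹ * γ)
    rw [← h1]
    group
  have hLc : ∀ γ, Continuous (L γ) := by
    intro γ
    rw [continuous_iff_continuousAt]
    intro z
    obtain ⟨i, hi⟩ := hA z
    have h1 : (fun w => (Z.localTriv i).toOpenPartialHomeomorph.symm (P w, (F i z)⁻¹ * γ))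
        =ᶠ[𝓝 z] L γ := by
      filter_upwards [hF i z hi, (hAo i).mem_nhds hi] with w hw hwA
      rw [hL γ i w hwA, hw]
    refine ContinuousAt.congr ?_ h1
    refine ContinuousAt.comp (g := (Z.localTriv i).toOpenPartialHomeomorph.symm)
      (OpenPartialHomeomorph.continuousAt_symm _ ?_) (by fun_prop)
    exact (Z.mem_localTriv_target i _).mpr (hbase i z hi)
  let y : Γ → Z.proj ⁻¹' {P z₀} := fun γ => ⟨L γ z₀, rfl⟩
  -- `L γ` carries the path from `z₀` to `z` to a lift of its image, which computes the monodromy.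
  have hmon : ∀ γ z, cov.monodromy (lift P z₀ z).2 (y γ) = ⟨L γ z, rfl⟩ := fun γ z =>
    cov.monodromy_map ((Path.Homotopic.Quotient.mk (PathConnectedSpace.somePath z₀ z)).map
      ⟨L γ, hLc γ⟩)
  refine ⟨_, cov.monodromyPerm (P z₀), y, ?_, ?_⟩
  · intro γ δ h
    have h1 : L γ z₀ = L δ z₀ := congrArg Subtype.val h
    exact mul_left_cancel (eq_of_heq (Bundle.TotalSpace.mk.inj h1).2)
  · intro i k z w hz hw hk γ
    have h1 : (⟨P z, (lift P z₀ z).2⟩ : BasedPath (P z₀)) =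
      ⟨P w, Path.Homotopic.Quotient.trans k (lift P z₀ w).2⟩ := hk
    have hzw : P z = P w := congrArg Sigma.fst h1
    have h2 : ∀ p q : BasedPath (P z₀), p = q →
        (cov.monodromy p.2 (y γ)).1 = (cov.monodromy q.2 (y γ)).1 := by
      rintro p q rfl; rfl
    have h3 := h2 _ _ h1
    rw [hmon, cov.monodromy_trans_apply] at h3
    -- The factor is forced by equating the coordinates `(F i z)⁻¹ * γ` and `(F i w)⁻¹ * γ'` in
    -- chart `i`.
    have h4 : L γ z = L (F i w * (F i z)⁻¹ * γ) w := by
      rw [hL _ i z hz, hL _ i w hw, hzw]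
      congr 2
      group
    refine (cov.monodromy_bijective (lift P z₀ w).2).1 ?_
    rw [hmon]
    exact Subtype.ext (h3.symm.trans h4)

end SimplyConnectedQuotient

/-! ### Polar coordinates on the model surface -/

namespace ModelSurface

open Set Topology

/-- Polar coordinates on the closed disc, seen as an `n`-gon: the `k`-th edge is `r = 1`,
`k ≤ θ ≤ k + 1`. -/
noncomputable def polarDisc (n : ℕ) (z : I × ℝ) : Metric.closedBall (0 : ℂ) 1 :=
  ⟨z.1 * Complex.exp (((2 * Real.pi * (z.2 / n) : ℝ) : ℂ) * Complex.I), by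
    rw [Metric.mem_closedBall, dist_zero_right, norm_mul, Complex.norm_exp_ofReal_mul_I, mul_one,
      Complex.norm_real, Real.norm_of_nonneg z.1.2.1]
    exact z.1.2.2⟩

theorem continuous_polarDisc (n : ℕ) : Continuous (polarDisc n) := by
  unfold polarDisc
  fun_prop

theorem polarDisc_one (n k : ℕ) (s : I) : polarDisc n (1, k + s) = polygonEdge n k s := by
  simp [polarDisc, polygonEdge]

theorem polarDisc_surjective {n : ℕ} (hn : 0 < n) (x : Metric.closedBall (0 : ℂ) 1) :
    ∃ r : I, ∃ θ ∈ Icc (0 : ℝ) n, polarDisc n (r, θ) = x := by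
  have hn' : (0 : ℝ) < n := by exact_mod_cast hn
  have hx : ‖x.1‖ ≤ 1 := mem_closedBall_zero_iff.mp x.2
  obtain ⟨φ, hφ, hφx⟩ : ∃ φ ∈ Ico (0 : ℝ) (0 + 2 * Real.pi),
      Complex.exp (φ * Complex.I) = Complex.exp (Complex.arg x.1 * Complex.I) := by
    refine ⟨toIcoMod Real.two_pi_pos 0 (Complex.arg x.1), toIcoMod_mem_Ico _ _ _, ?_⟩
    rw [Complex.exp_eq_exp_iff_exists_int]
    refine ⟨-toIcoDiv Real.two_pi_pos 0 (Complex.arg x.1), ?_⟩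
    rw [toIcoMod]
    push_cast [zsmul_eq_mul]
    ring
  refine ⟨⟨‖x.1‖, norm_nonneg _, hx⟩, φ / (2 * Real.pi) * n, ⟨?_, ?_⟩, Subtype.ext ?_⟩
  · have := hφ.1
    positivity
  · have h1 : φ / (2 * Real.pi) ≤ 1 := by
      rw [div_le_one Real.two_pi_pos]
      linarith [hφ.2]
    nlinarith
  · have h1 : 2 * Real.pi * (φ / (2 * Real.pi) * n / n) = φ := by
      field_simp
    simp only [polarDisc, h1, hφx]
    exact Complex.norm_mul_exp_arg_mul_I x.1

theorem isQuotientMap_polarDisc {n : ℕ} (hn : 0 < n) : IsQuotientMap (polarDisc n) := by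
  let f : I × Icc (0 : ℝ) n → I × ℝ := fun z => (z.1, z.2)
  have hf : Continuous f := by fun_prop
  refine IsQuotientMap.of_comp hf (continuous_polarDisc n) ?_
  refine IsQuotientMap.of_surjective_continuous (fun x => ?_) ((continuous_polarDisc n).comp hf)
  obtain ⟨r, θ, hθ, h⟩ := polarDisc_surjective hn x
  exact ⟨(r, ⟨θ, hθ⟩), h⟩

/-- Polar coordinates on the model surface of genus `g`. -/
noncomputable def polar (g : ℕ) : C(I × ℝ, ModelSurface g) :=
  ⟨fun z => Quot.mk _ (polarDisc (4 * g) z), continuous_quot_mk.comp (continuous_polarDisc _)⟩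

theorem isQuotientMap_polar {g : ℕ} (hg : 0 < g) : IsQuotientMap (polar g) :=
  isQuotientMap_quot_mk.comp (isQuotientMap_polarDisc (by lia))

theorem polar_zero (g : ℕ) (θ θ' : ℝ) : polar g (0, θ) = polar g (0, θ') :=
  congrArg (Quot.mk _) (Subtype.ext (by simp [polarDisc]))

theorem polar_add {g : ℕ} (hg : 0 < g) (r : I) (θ : ℝ) :
    polar g (r, θ + 4 * g) = polar g (r, θ) := by
  refine congrArg (Quot.mk _) (Subtype.ext ?_)
  have hg' : (g : ℝ) ≠ 0 := by exact_mod_cast hg.ne'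
  have h1 : 2 * Real.pi * ((θ + 4 * g) / ((4 * g : ℕ) : ℝ)) =
      2 * Real.pi * (θ / ((4 * g : ℕ) : ℝ)) + 2 * Real.pi := by
    push_cast
    field_simp
  simp only [polarDisc, h1]
  push_cast
  rw [add_mul, Complex.exp_add, Complex.exp_two_pi_mul_I, mul_one]

theorem polar_a {g j : ℕ} (hj : j < g) (s : I) :
    polar g (1, 4 * j + s) = polar g (1, 4 * j + 3 - s) := by
  have h := Quot.sound (PolygonGluing.a j hj s)
  rw [← polarDisc_one, ← polarDisc_one] at h
  have h1 : (4 * j + 3 - s : ℝ) = ((4 * j + 2 : ℕ) : ℝ) + (σ s : ℝ) := by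
    push_cast; rw [unitInterval.coe_symm_eq]; ring
  have h2 : (4 * j + s : ℝ) = ((4 * j : ℕ) : ℝ) + (s : ℝ) := by push_cast; rfl
  rw [h1, h2]
  exact h

theorem polar_b {g j : ℕ} (hj : j < g) (s : I) :
    polar g (1, 4 * j + 1 + s) = polar g (1, 4 * j + 4 - s) := by
  have h := Quot.sound (PolygonGluing.b j hj s)
  rw [← polarDisc_one, ← polarDisc_one] at h
  have h1 : (4 * j + 4 - s : ℝ) = ((4 * j + 3 : ℕ) : ℝ) + (σ s : ℝ) := by
    push_cast; rw [unitInterval.coe_symm_eq]; ring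
  have h2 : (4 * j + 1 + s : ℝ) = ((4 * j + 1 : ℕ) : ℝ) + (s : ℝ) := by push_cast; rfl
  rw [h1, h2]
  exact h

/-- The kernel of the polar coordinate map is the equivalence relation generated by the obvious
identifications. -/
theorem rel_of_polar_eq {g : ℕ} (hg : 0 < g) {R : I × ℝ → I × ℝ → Prop} (hR : Equivalence R)
    (h0 : ∀ θ θ', R (0, θ) (0, θ')) (hper : ∀ r θ, R (r, θ + 4 * g) (r, θ))
    (ha : ∀ j < g, ∀ s : I, R (1, 4 * j + s) (1, 4 * j + 3 - s))
    (hb : ∀ j < g, ∀ s : I, R (1, 4 * j + 1 + s) (1, 4 * j + 4 - s)) {z w : I × ℝ}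
    (hzw : polar g z = polar g w) : R z w := by
  have hg' : (g : ℝ) ≠ 0 := by exact_mod_cast hg.ne'
  -- Two polar coordinates of one point of the disc have equal radius, and angles that differ by a
  -- multiple of the period unless the point is the centre.
  have hdisc : ∀ z w, polarDisc (4 * g) z = polarDisc (4 * g) w → R z w := by
    rintro ⟨r, θ⟩ ⟨r', θ'⟩ h
    have h1 := congrArg Subtype.val h
    have h2 := congrArg norm h1
    simp only [polarDisc, norm_mul, Complex.norm_exp_ofReal_mul_I, mul_one, Complex.norm_real,
      Real.norm_of_nonneg r.2.1, Real.norm_of_nonneg r'.2.1] at h2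
    obtain rfl : r = r' := Subtype.ext h2
    by_cases hr : r = 0
    · subst hr
      exact h0 _ _
    have hr' : ((r : ℝ) : ℂ) ≠ 0 := by
      rw [Complex.ofReal_ne_zero]
      exact fun h => hr (Subtype.ext h)
    have h3 := mul_left_cancel₀ hr' h1
    rw [Complex.exp_eq_exp_iff_exists_int] at h3
    obtain ⟨k, hk⟩ := h3
    have h4 : θ = θ' + k * (4 * g) := by
      have h5 : 2 * Real.pi * (θ / ((4 * g : ℕ) : ℝ)) =
          2 * Real.pi * (θ' / ((4 * g : ℕ) : ℝ)) + k * (2 * Real.pi) := by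
        have h6 : ((2 * Real.pi * (θ / ((4 * g : ℕ) : ℝ)) : ℝ) : ℂ) * Complex.I =
            ((2 * Real.pi * (θ' / ((4 * g : ℕ) : ℝ)) + k * (2 * Real.pi) : ℝ) : ℂ) *
              Complex.I := by
          rw [hk]
          push_cast
          ring
        exact Complex.ofReal_injective (mul_right_cancel₀ Complex.I_ne_zero h6)
      push_cast at h5
      field_simp at h5
      linarith
    have hint : ∀ (k : ℤ) θ, R (r, θ + k * (4 * g)) (r, θ) := by
      intro k
      induction k using Int.induction_on with
      | zero => intro θ; simpa using hR.refl _
      | succ k ih =>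
        intro θ
        have := hper r (θ + k * (4 * g))
        refine hR.trans ?_ (hR.trans this (by simpa using ih θ))
        convert hR.refl _ using 2
        push_cast; ring
      | pred k ih =>
        intro θ
        have := hper r (θ + ((-k - 1 : ℤ) : ℝ) * (4 * g))
        refine hR.trans (hR.symm this) (hR.trans ?_ (ih θ))
        convert hR.refl _ using 2
        push_cast; ring
    rw [h4]
    exact hint k θ'
  have hedge : ∀ (k : ℕ) (s : I), polarDisc (4 * g) (1, k + s) = polygonEdge (4 * g) k s :=
    polarDisc_one (4 * g)
  have key : ∀ x y, Relation.EqvGen (PolygonGluing g) x y →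
      ∀ z w, polarDisc (4 * g) z = x → polarDisc (4 * g) w = y → R z w := by
    intro x y h
    induction h with
    | rel x y h =>
      intro z w hz hw
      cases h with
      | a j hj s =>
        rw [← hedge] at hz hw
        refine hR.trans (hdisc _ _ hz) (hR.trans ?_ (hR.symm (hdisc _ _ hw)))
        convert ha j hj s using 2
        · push_cast; rfl
        · push_cast; rw [unitInterval.coe_symm_eq]; ring
      | b j hj s =>
        rw [← hedge] at hz hw
        refine hR.trans (hdisc _ _ hz) (hR.trans ?_ (hR.symm (hdisc _ _ hw)))
        convert hb j hj s using 2
        · push_cast; rfl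
        · push_cast; rw [unitInterval.coe_symm_eq]; ring
    | refl x => exact fun z w hz hw => hdisc _ _ (hz.trans hw.symm)
    | symm x y _ ih => exact fun z w hz hw => hR.symm (ih w z hw hz)
    | trans x y t _ _ ih1 ih2 =>
      intro z w hz hw
      obtain ⟨r, θ, -, h⟩ := polarDisc_surjective (n := 4 * g) (by lia) y
      exact hR.trans (ih1 z _ hz h) (ih2 _ w h hw)
  exact key _ _ (Quot.eqvGen_exact hzw) z w rfl rfl

/-- The edges `m` of the `4 g`-gon that are glued, with reversed direction, to the edge `m + 2`. -/
def IsLeadingEdge (g m : ℕ) : Prop :=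
  ∃ j < g, m = 4 * j ∨ m = 4 * j + 1

theorem polar_edge {g m : ℕ} (hm : IsLeadingEdge g m) (s : I) :
    polar g (1, m + s) = polar g (1, m + 3 - s) := by
  obtain ⟨j, hj, rfl | rfl⟩ := hm
  · have := polar_a hj s
    push_cast
    exact this
  · have := polar_b hj s
    push_cast
    rw [this]
    congr 2
    ring

/-- The kernel of the polar coordinate map is the equivalence relation generated by the obvious
identifications. -/
theorem rel_of_polar_eq_of_edge {g : ℕ} (hg : 0 < g) {R : I × ℝ → I × ℝ → Prop}
    (hR : Equivalence R) (h0 : ∀ θ θ', R (0, θ) (0, θ')) (hper : ∀ r θ, R (r, θ + 4 * g) (r, θ))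
    (he : ∀ m, IsLeadingEdge g m → ∀ s : I, R (1, m + s) (1, m + 3 - s)) {z w : I × ℝ}
    (hzw : polar g z = polar g w) : R z w := by
  refine rel_of_polar_eq hg hR h0 hper (fun j hj s => ?_) (fun j hj s => ?_) hzw
  · have := he (4 * j) ⟨j, hj, Or.inl rfl⟩ s
    push_cast at this
    exact this
  · have := he (4 * j + 1) ⟨j, hj, Or.inr rfl⟩ s
    push_cast at this
    rwa [show (4 * j + 1 + 3 - s : ℝ) = 4 * j + 4 - s by ring] at this

/-- The endpoints of the two glued pairs in one block of four edges already identify all five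
vertices of the block. -/
theorem polar_vertex_add_one {g : ℕ} (k : ℕ) (hk : k < 4 * g) :
    polar g (1, k + 1) = polar g (1, k) := by
  obtain ⟨j, i, hi, rfl⟩ : ∃ j i, i < 4 ∧ k = 4 * j + i := ⟨k / 4, k % 4, by lia, by lia⟩
  have hj : j < g := by lia
  have a0 := polar_a hj 0
  have a1 := polar_a hj 1
  have b0 := polar_b hj 0
  have b1 := polar_b hj 1
  simp only [Set.Icc.coe_zero, Set.Icc.coe_one, add_zero, sub_zero] at a0 a1 b0 b1
  rw [show (4 * j + 3 - 1 : ℝ) = 4 * j + 2 by ring] at a1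
  rw [show (4 * j + 4 - 1 : ℝ) = 4 * j + 3 by ring, show (4 * j + 1 + 1 : ℝ) = 4 * j + 2 by ring]
    at b1
  have e1 : (4 * j + 1 + 1 : ℝ) = 4 * j + 2 := by ring
  have e2 : (4 * j + 2 + 1 : ℝ) = 4 * j + 3 := by ring
  have e3 : (4 * j + 3 + 1 : ℝ) = 4 * j + 4 := by ring
  interval_cases i <;> push_cast <;> simp only [add_zero, e1, e2, e3]
  · rw [a1, b1, a0]
  · rw [a1]
  · rw [b1]
  · rw [← b0, a1, b1]

theorem polar_add_int_mul {g : ℕ} (hg : 0 < g) (r : I) (θ : ℝ) (k : ℤ) :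
    polar g (r, θ + k * (4 * g)) = polar g (r, θ) := by
  have hp : Function.Periodic (fun θ => polar g (r, θ)) (4 * g : ℝ) := fun θ => polar_add hg r θ
  exact hp.int_mul k θ

theorem polar_vertex {g : ℕ} (hg : 0 < g) (k : ℤ) : polar g (1, k) = polar g (1, 0) := by
  have hnat : ∀ k : ℕ, k ≤ 4 * g → polar g (1, k) = polar g (1, 0) := by
    intro k
    induction k with
    | zero => intro; simp
    | succ k ih =>
      intro hk
      push_cast
      rw [polar_vertex_add_one k (by lia), ih (by lia)]
  have h1 := Int.emod_nonneg k (b := 4 * g) (by lia)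
  have h2 := Int.emod_lt_of_pos k (b := 4 * g) (by lia)
  obtain ⟨r, hr⟩ := Int.eq_ofNat_of_zero_le h1
  have h3 : (k : ℝ) = r + (k / (4 * g) : ℤ) * (4 * g) := by
    have := Int.emod_add_mul_ediv k (4 * g)
    rw [hr] at this
    have h4 : (k : ℝ) = ((r + 4 * g * (k / (4 * g)) : ℤ) : ℝ) := by rw [this]
    rw [h4]
    push_cast
    ring
  rw [h3, polar_add_int_mul hg, hnat r (by lia)]

end ModelSurface

/-! ### Contractible charts of the model surface -/

namespace ModelSurface

open Set Topology SimplyConnectedQuotient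

theorem eventually_floor_eq {θ : ℝ} (h : (⌊θ⌋ : ℝ) < θ) : ∀ᶠ θ' in 𝓝 θ, ⌊θ'⌋ = ⌊θ⌋ := by
  filter_upwards [Ioo_mem_nhds h (Int.lt_floor_add_one θ)] with θ' h'
  rw [Int.floor_eq_iff]
  exact ⟨h'.1.le, h'.2⟩

theorem eventually_floor_eq_and_lt {θ : ℝ} (h : (⌊θ⌋ : ℝ) < θ) :
    ∀ᶠ θ' in 𝓝 θ, ⌊θ'⌋ = ⌊θ⌋ ∧ (⌊θ'⌋ : ℝ) < θ' := by
  filter_upwards [eventually_floor_eq h, lt_mem_nhds h] with θ' h1 h2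
  exact ⟨h1, h1 ▸ h2⟩

/-- The complement of the centre and of the vertices' radii. -/
def edgeDomain : Set (I × ℝ) := {z | z.1 ≠ 0 ∧ (⌊z.2⌋ : ℝ) < z.2}

/-- The complement of the centre and of the radii through the middles of the edges. -/
def vertexDomain : Set (I × ℝ) := {z | z.1 ≠ 0 ∧ (⌊z.2 + 1 / 2⌋ : ℝ) < z.2 + 1 / 2}

/-- The interior of the polygon. -/
def interiorDomain : Set (I × ℝ) := {z | z.1 ≠ 1}

theorem eventually_edgeDomain {z : I × ℝ} (hz : z ∈ edgeDomain) :
    ∀ᶠ w in 𝓝 z, w ∈ edgeDomain ∧ ⌊w.2⌋ = ⌊z.2⌋ := by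
  filter_upwards [continuousAt_snd.eventually (eventually_floor_eq_and_lt hz.2),
    continuousAt_fst.eventually (isOpen_ne.mem_nhds hz.1)] with w h1 h2
  exact ⟨⟨h2, h1.2⟩, h1.1⟩

theorem eventually_vertexDomain {z : I × ℝ} (hz : z ∈ vertexDomain) :
    ∀ᶠ w in 𝓝 z, w ∈ vertexDomain ∧ ⌊w.2 + 1 / 2⌋ = ⌊z.2 + 1 / 2⌋ := by
  have h : ContinuousAt (fun w : I × ℝ => w.2 + 1 / 2) z := by fun_prop
  filter_upwards [h.eventually (eventually_floor_eq_and_lt hz.2),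
    continuousAt_fst.eventually (isOpen_ne.mem_nhds hz.1)] with w h1 h2
  exact ⟨⟨h2, h1.2⟩, h1.1⟩

theorem isOpen_edgeDomain : IsOpen edgeDomain :=
  isOpen_iff_eventually.mpr fun _ hz => (eventually_edgeDomain hz).mono fun _ h => h.1

theorem isOpen_vertexDomain : IsOpen vertexDomain :=
  isOpen_iff_eventually.mpr fun _ hz => (eventually_vertexDomain hz).mono fun _ h => h.1

theorem isOpen_interiorDomain : IsOpen interiorDomain :=
  isOpen_ne.preimage continuous_fst

/-- On the boundary circle, an angle is either not an integer, hence inside an edge, or an integer,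
hence not the middle of an edge. -/
theorem mem_domain (z : I × ℝ) : z ∈ interiorDomain ∨ z ∈ edgeDomain ∨ z ∈ vertexDomain := by
  by_cases h : z ∈ interiorDomain
  · exact Or.inl h
  obtain ⟨r, θ⟩ := z
  obtain rfl : r = 1 := by simpa [interiorDomain] using h
  right
  by_cases h1 : (⌊θ⌋ : ℝ) < θ
  · exact Or.inl ⟨one_ne_zero, h1⟩
  · right
    refine ⟨one_ne_zero, ?_⟩
    have h2 : (⌊θ⌋ : ℝ) = θ := le_antisymm (Int.floor_le θ) (not_lt.mp h1)
    have h3 : ⌊θ + 1 / 2⌋ = ⌊θ⌋ := by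
      rw [Int.floor_eq_iff, h2]
      constructor <;> norm_num
    change (⌊θ + 1 / 2⌋ : ℝ) < θ + 1 / 2
    rw [h3, h2]
    norm_num

theorem floor_add_coe {m : ℤ} {s : ℝ} (h0 : 0 ≤ s) (h1 : s < 1) : ⌊m + s⌋ = m := by
  rw [Int.floor_eq_iff]
  constructor <;> linarith

theorem mem_edgeDomain_one {m : ℤ} {s : I} : ((1, m + s) : I × ℝ) ∈ edgeDomain ↔
    0 < (s : ℝ) ∧ (s : ℝ) < 1 := by
  change (1 : I) ≠ 0 ∧ (⌊(m + s : ℝ)⌋ : ℝ) < m + s ↔ _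
  rw [Int.floor_intCast_add]
  push_cast
  have h0 := s.2.1
  have h1 := s.2.2
  refine ⟨fun ⟨_, h⟩ => ?_, fun ⟨h2, h3⟩ => ⟨one_ne_zero, ?_⟩⟩
  · have h2 := Int.self_sub_floor (s : ℝ)
    rcases h1.lt_or_eq with h3 | h3
    · have : ⌊(s : ℝ)⌋ = 0 := Int.floor_eq_zero_iff.mpr ⟨h0, h3⟩
      rw [this] at h
      push_cast at h
      exact ⟨by linarith, h3⟩
    · rw [h3] at h
      simp at h
  · have : ⌊(s : ℝ)⌋ = 0 := Int.floor_eq_zero_iff.mpr ⟨h0, h3⟩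
    rw [this]
    push_cast
    linarith

theorem floor_add_half_of_lt {m : ℤ} {s : ℝ} (h0 : 0 ≤ s) (h1 : s < 1 / 2) :
    ⌊m + s + 1 / 2⌋ = m := by
  rw [Int.floor_eq_iff]
  constructor <;> linarith

theorem floor_add_half_of_ge {m : ℤ} {s : ℝ} (h0 : 1 / 2 ≤ s) (h1 : s ≤ 1) :
    ⌊m + s + 1 / 2⌋ = m + 1 := by
  rw [Int.floor_eq_iff]
  push_cast
  constructor <;> linarith

theorem mem_vertexDomain_one {m : ℤ} {s : I} : ((1, m + s) : I × ℝ) ∈ vertexDomain ↔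
    (s : ℝ) ≠ 1 / 2 := by
  change (1 : I) ≠ 0 ∧ (⌊(m + s + 1 / 2 : ℝ)⌋ : ℝ) < m + s + 1 / 2 ↔ _
  have h0 := s.2.1
  have h1 := s.2.2
  rcases lt_or_ge (s : ℝ) (1 / 2) with h | h
  · rw [floor_add_half_of_lt h0 h]
    exact ⟨fun _ => h.ne, fun _ => ⟨one_ne_zero, by linarith⟩⟩
  · rw [floor_add_half_of_ge h h1]
    push_cast
    refine ⟨fun h2 h3 => ?_, fun h2 => ⟨one_ne_zero, ?_⟩⟩
    · have := h2.2
      linarith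
    · have := lt_of_le_of_ne h h2.symm
      linarith

theorem add_three_sub (m : ℕ) (s : I) :
    (m + 3 - s : ℝ) = ((m + 2 : ℕ) : ℤ) + (σ s : ℝ) := by
  push_cast
  rw [unitInterval.coe_symm_eq]
  ring

theorem mem_edgeDomain_edge (m : ℕ) (s : I) :
    ((1, m + s) : I × ℝ) ∈ edgeDomain ↔ ((1, m + 3 - s) : I × ℝ) ∈ edgeDomain := by
  rw [add_three_sub, ← Int.cast_natCast (R := ℝ) m, mem_edgeDomain_one, mem_edgeDomain_one,
    unitInterval.coe_symm_eq]
  constructor <;> rintro ⟨h1, h2⟩ <;> constructor <;> linarith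

theorem mem_vertexDomain_edge (m : ℕ) (s : I) :
    ((1, m + s) : I × ℝ) ∈ vertexDomain ↔ ((1, m + 3 - s) : I × ℝ) ∈ vertexDomain := by
  rw [add_three_sub, ← Int.cast_natCast (R := ℝ) m, mem_vertexDomain_one, mem_vertexDomain_one,
    unitInterval.coe_symm_eq]
  constructor <;> intro h1 h2 <;> apply h1 <;> linarith

theorem floor_add_period (g : ℕ) (θ : ℝ) : ⌊θ + 4 * g⌋ = ⌊θ⌋ + 4 * g := by
  have := Int.floor_add_natCast θ (4 * g)
  push_cast at this
  exact this

theorem floor_add_period_half (g : ℕ) (θ : ℝ) :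
    ⌊θ + 4 * g + 1 / 2⌋ = ⌊θ + 1 / 2⌋ + 4 * g := by
  rw [add_right_comm, floor_add_period]

theorem mem_edgeDomain_add (g : ℕ) (r : I) (θ : ℝ) :
    (r, θ + 4 * g) ∈ edgeDomain ↔ (r, θ) ∈ edgeDomain := by
  change r ≠ 0 ∧ (⌊θ + 4 * g⌋ : ℝ) < θ + 4 * g ↔ r ≠ 0 ∧ (⌊θ⌋ : ℝ) < θ
  rw [floor_add_period]
  push_cast
  rw [add_lt_add_iff_right]

theorem mem_vertexDomain_add (g : ℕ) (r : I) (θ : ℝ) :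
    (r, θ + 4 * g) ∈ vertexDomain ↔ (r, θ) ∈ vertexDomain := by
  change r ≠ 0 ∧ (⌊θ + 4 * g + 1 / 2⌋ : ℝ) < θ + 4 * g + 1 / 2 ↔
    r ≠ 0 ∧ (⌊θ + 1 / 2⌋ : ℝ) < θ + 1 / 2
  rw [floor_add_period_half]
  push_cast
  rw [add_right_comm, add_lt_add_iff_right]

variable {g : ℕ}

theorem isNullChart_interiorDomain (hg : 0 < g) : IsNullChart (polar g) interiorDomain := by
  -- Radial contraction to the centre.
  refine ⟨isOpen_interiorDomain, fun q => (σ q.2 * q.1.1, q.1.2), polar g (0, 0), ?_, ?_, ?_, ?_⟩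
  · exact Continuous.continuousOn (by fun_prop)
  · rintro ⟨r, θ⟩ -
    simp
  · rintro ⟨r, θ⟩ -
    simpa using polar_zero g θ 0
  · intro z w hzw hz
    have key : ((z ∈ interiorDomain ↔ w ∈ interiorDomain) ∧ (z ∈ interiorDomain → ∀ t : I,
        polar g (σ t * z.1, z.2) = polar g (σ t * w.1, w.2))) := by
      refine rel_of_polar_eq_of_edge hg (R := fun z w => ((z ∈ interiorDomain ↔ w ∈ interiorDomain)
        ∧ (z ∈ interiorDomain → ∀ t : I, polar g (σ t * z.1, z.2) = polar g (σ t * w.1, w.2))))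
        ⟨?_, ?_, ?_⟩ ?_ ?_ ?_ hzw
      · exact fun z => ⟨Iff.rfl, fun _ _ => rfl⟩
      · exact fun h => ⟨h.1.symm, fun hz t => (h.2 (h.1.mpr hz) t).symm⟩
      · exact fun h h' => ⟨h.1.trans h'.1, fun hz t => (h.2 hz t).trans (h'.2 (h.1.mp hz) t)⟩
      · intro θ θ'
        refine ⟨Iff.rfl, fun _ t => ?_⟩
        simpa using polar_zero g θ θ'
      · intro r θ
        exact ⟨Iff.rfl, fun _ t => polar_add hg _ _⟩
      · intro m hm s
        exact ⟨Iff.rfl, fun h => absurd rfl h⟩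
    exact ⟨key.1.mp hz, key.2 hz⟩

/-- Each open sector over an edge is pushed out to the boundary and onto the middle of its edge. A
null chart must end at one point, so only the sectors whose middle has the prescribed image `c` are
kept. The deformation respects the gluing because reversal of an edge fixes its middle. -/
theorem isNullChart_edgeDomain (hg : 0 < g) (c : ModelSurface g) :
    IsNullChart (polar g) {z | z ∈ edgeDomain ∧ polar g (1, ⌊z.2⌋ + 1 / 2) = c} := by
  have hopen : IsOpen {z : I × ℝ | z ∈ edgeDomain ∧ polar g (1, ⌊z.2⌋ + 1 / 2) = c} := by
    refine isOpen_iff_eventually.mpr fun z hz => ?_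
    filter_upwards [eventually_edgeDomain hz.1] with w hw
    exact ⟨hw.1, by rw [hw.2]; exact hz.2⟩
  -- The radius is `1 - (1 - t) * (1 - r)`: it moves from `r` to `1` and stays at `1` on the
  -- boundary. The floor is constant on each sector, so the angle is continuous.
  let h : (I × ℝ) × I → I × ℝ := fun q =>
    (σ (σ q.2 * σ q.1.1), ⌊q.1.2⌋ + ((1 - q.2) * (q.1.2 - ⌊q.1.2⌋) + q.2 * (1 / 2)))
  refine ⟨hopen, h, c, ?_, ?_, ?_, ?_⟩
  · rintro ⟨z, t⟩ ⟨hz, -⟩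
    refine ContinuousAt.continuousWithinAt ?_
    have h1 : (fun q : (I × ℝ) × I => ((σ (σ q.2 * σ q.1.1),
        ⌊z.2⌋ + ((1 - q.2) * (q.1.2 - ⌊z.2⌋) + q.2 * (1 / 2))) : I × ℝ)) =ᶠ[𝓝 (z, t)] h := by
      filter_upwards [continuousAt_fst.eventually (eventually_edgeDomain hz.1)] with q hq
      simp only [h, hq.2]
    exact ContinuousAt.congr (by fun_prop) h1
  · rintro ⟨r, θ⟩ -
    simp [h]
  · rintro ⟨r, θ⟩ hz
    simpa [h] using hz.2
  · intro z w hzw hz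
    have key : (z ∈ edgeDomain ↔ w ∈ edgeDomain) ∧ (z ∈ edgeDomain →
        polar g (1, ⌊z.2⌋ + 1 / 2) = polar g (1, ⌊w.2⌋ + 1 / 2) ∧
        ∀ t : I, polar g (h (z, t)) = polar g (h (w, t))) := by
      refine rel_of_polar_eq_of_edge hg (R := fun z w => (z ∈ edgeDomain ↔ w ∈ edgeDomain) ∧
        (z ∈ edgeDomain → polar g (1, ⌊z.2⌋ + 1 / 2) = polar g (1, ⌊w.2⌋ + 1 / 2) ∧
        ∀ t : I, polar g (h (z, t)) = polar g (h (w, t)))) ⟨?_, ?_, ?_⟩ ?_ ?_ ?_ hzw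
      · exact fun z => ⟨Iff.rfl, fun _ => ⟨rfl, fun _ => rfl⟩⟩
      · exact fun h => ⟨h.1.symm, fun hz => ⟨(h.2 (h.1.mpr hz)).1.symm,
          fun t => ((h.2 (h.1.mpr hz)).2 t).symm⟩⟩
      · exact fun h h' => ⟨h.1.trans h'.1, fun hz => ⟨(h.2 hz).1.trans (h'.2 (h.1.mp hz)).1,
          fun t => ((h.2 hz).2 t).trans ((h'.2 (h.1.mp hz)).2 t)⟩⟩
      · intro θ θ'
        exact ⟨⟨fun h => absurd rfl h.1, fun h => absurd rfl h.1⟩, fun h => absurd rfl h.1⟩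
      · intro r θ
        refine ⟨mem_edgeDomain_add g r θ, fun _ => ⟨?_, fun t => ?_⟩⟩
        · rw [floor_add_period]
          refine Eq.trans ?_ (polar_add hg _ _)
          congr 2
          push_cast; ring
        · simp only [h, floor_add_period]
          refine Eq.trans ?_ (polar_add hg _ _)
          congr 2
          push_cast; ring
      · intro m hm s
        refine ⟨mem_edgeDomain_edge m s, fun hs => ?_⟩
        have hs' : 0 < (s : ℝ) ∧ (s : ℝ) < 1 := by
          rwa [← Int.cast_natCast (R := ℝ) m, mem_edgeDomain_one] at hs
        have h1 : ⌊(m + s : ℝ)⌋ = m := floor_add_coe (m := m) hs'.1.le hs'.2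
        have h2 : ⌊(m + 3 - s : ℝ)⌋ = m + 2 := by
          rw [Int.floor_eq_iff]
          push_cast
          constructor <;> linarith [hs'.1, hs'.2]
        have h3 : ∀ x : ℝ, 0 ≤ x → x ≤ 1 → polar g (1, m + x) = polar g (1, m + 3 - x) :=
          fun x hx0 hx1 => polar_edge hm ⟨x, hx0, hx1⟩
        refine ⟨?_, fun t => ?_⟩
        · simp only [h1, h2]
          push_cast
          rw [h3 (1 / 2) (by norm_num) (by norm_num)]
          congr 2
          ring
        · simp only [h, h1, h2]
          have ht0 := t.2.1
          have ht1 := t.2.2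
          simp only [unitInterval.symm_one, mul_zero, unitInterval.symm_zero]
          push_cast
          rw [h3 _ (by nlinarith) (by nlinarith)]
          congr 2
          ring
    exact ⟨⟨key.1.mp hz.1, (key.2 hz.1).1.symm.trans hz.2⟩, (key.2 hz.1).2⟩

/-- Each point is pushed out to the boundary and to the nearest vertex; all vertices have the same
image, so one chart serves for all of them. -/
theorem isNullChart_vertexDomain (hg : 0 < g) : IsNullChart (polar g) vertexDomain := by
  let h : (I × ℝ) × I → I × ℝ := fun q =>
    (σ (σ q.2 * σ q.1.1), (1 - q.2) * q.1.2 + q.2 * ⌊q.1.2 + 1 / 2⌋)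
  refine ⟨isOpen_vertexDomain, h, polar g (1, 0), ?_, ?_, ?_, ?_⟩
  · rintro ⟨z, t⟩ ⟨hz, -⟩
    refine ContinuousAt.continuousWithinAt ?_
    have h1 : (fun q : (I × ℝ) × I => ((σ (σ q.2 * σ q.1.1),
        (1 - q.2) * q.1.2 + q.2 * ⌊z.2 + 1 / 2⌋) : I × ℝ)) =ᶠ[𝓝 (z, t)] h := by
      filter_upwards [continuousAt_fst.eventually (eventually_vertexDomain hz)] with q hq
      simp only [h, hq.2]
    exact ContinuousAt.congr (by fun_prop) h1
  · rintro ⟨r, θ⟩ -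
    simp [h]
  · rintro ⟨r, θ⟩ hz
    simpa [h] using polar_vertex hg ⌊θ + 1 / 2⌋
  · intro z w hzw hz
    have key : (z ∈ vertexDomain ↔ w ∈ vertexDomain) ∧ (z ∈ vertexDomain →
        ∀ t : I, polar g (h (z, t)) = polar g (h (w, t))) := by
      refine rel_of_polar_eq_of_edge hg (R := fun z w => (z ∈ vertexDomain ↔ w ∈ vertexDomain) ∧
        (z ∈ vertexDomain → ∀ t : I, polar g (h (z, t)) = polar g (h (w, t))))
        ⟨?_, ?_, ?_⟩ ?_ ?_ ?_ hzw
      · exact fun z => ⟨Iff.rfl, fun _ _ => rfl⟩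
      · exact fun h => ⟨h.1.symm, fun hz t => (h.2 (h.1.mpr hz) t).symm⟩
      · exact fun h h' => ⟨h.1.trans h'.1, fun hz t => (h.2 hz t).trans (h'.2 (h.1.mp hz) t)⟩
      · intro θ θ'
        exact ⟨⟨fun h => absurd rfl h.1, fun h => absurd rfl h.1⟩, fun h => absurd rfl h.1⟩
      · intro r θ
        refine ⟨mem_vertexDomain_add g r θ, fun _ t => ?_⟩
        simp only [h, floor_add_period_half]
        refine Eq.trans ?_ (polar_add hg _ _)
        congr 2
        push_cast; ring
      · intro m hm s
        refine ⟨mem_vertexDomain_edge m s, fun hs t => ?_⟩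
        have h3 : ∀ x : ℝ, 0 ≤ x → x ≤ 1 → polar g (1, m + x) = polar g (1, m + 3 - x) :=
          fun x hx0 hx1 => polar_edge hm ⟨x, hx0, hx1⟩
        have hs0 := s.2.1
        have hs1 := s.2.2
        have ht0 := t.2.1
        have ht1 := t.2.2
        simp only [h, unitInterval.symm_one, mul_zero, unitInterval.symm_zero]
        rw [← Int.cast_natCast (R := ℝ) m, mem_vertexDomain_one] at hs
        -- Reversal exchanges the halves of an edge: the start of edge `m` is glued to the end of
        -- edge `m + 2`, and conversely.
        rcases lt_or_gt_of_ne hs with hs' | hs'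
        · have h1 : ⌊(m + s + 1 / 2 : ℝ)⌋ = m := floor_add_half_of_lt (m := m) hs0 hs'
          have h2 : ⌊(m + 3 - s + 1 / 2 : ℝ)⌋ = m + 3 := by
            rw [Int.floor_eq_iff]
            push_cast
            constructor <;> linarith
          rw [h1, h2]
          push_cast
          rw [show (1 - t : ℝ) * (m + s) + t * m = m + (1 - t) * s by ring,
            h3 _ (by nlinarith) (by nlinarith)]
          congr 2
          ring
        · have h1 : ⌊(m + s + 1 / 2 : ℝ)⌋ = m + 1 := floor_add_half_of_ge (m := m) hs'.le hs1
          have h2 : ⌊(m + 3 - s + 1 / 2 : ℝ)⌋ = m + 2 := by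
            rw [Int.floor_eq_iff]
            push_cast
            constructor <;> linarith
          rw [h1, h2]
          push_cast
          rw [show (1 - t : ℝ) * (m + s) + t * (m + 1) = m + ((1 - t) * s + t) by ring,
            h3 _ (by nlinarith) (by nlinarith)]
          congr 2
          ring
    exact ⟨key.1.mp hz, key.2 hz⟩

theorem exists_isNullChart (hg : 0 < g) (z : I × ℝ) :
    ∃ A, z ∈ A ∧ IsNullChart (polar g) A := by
  rcases mem_domain z with h | h | h
  · exact ⟨_, h, isNullChart_interiorDomain hg⟩
  · exact ⟨_, And.intro h rfl, isNullChart_edgeDomain hg (polar g (1, ⌊z.2⌋ + 1 / 2))⟩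
  · exact ⟨_, h, isNullChart_vertexDomain hg⟩

end ModelSurface

/-! ### The fundamental group of the model surface -/

namespace ModelSurface

open Set Topology SimplyConnectedQuotient BasedPath

instance : ContractibleSpace I := (convex_Icc (0 : ℝ) 1).contractibleSpace ⟨0, by simp⟩

variable {g : ℕ}

/-- The segment of polar coordinates of the centre maps to a constant path. -/
theorem lift_zero (z₀ : I × ℝ) (θ θ' : ℝ) :
    lift (polar g) z₀ (0, θ) = lift (polar g) z₀ (0, θ') := by
  have h := lift_eq_precomp_of_path (polar g) z₀ (k := 1)
    (z' := (0, θ)) (w' := (0, θ')) (precomp_one (lift (polar g) z₀ (0, θ'))).symm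
    ⟨⟨fun t : I => ((0 : I), θ' + t * (θ - θ')), by fun_prop⟩, by simp, by simp⟩
    (Path.refl (0, θ')) fun t => polar_zero g _ _
  rw [h, precomp_one]

/-- Both points are reached from the centre along radii with the same image. -/
theorem lift_add (hg : 0 < g) (z₀ : I × ℝ) (r : I) (θ : ℝ) :
    lift (polar g) z₀ (r, θ + 4 * g) = lift (polar g) z₀ (r, θ) := by
  have h := lift_eq_precomp_of_path (polar g) z₀ (k := 1)
    (z' := (r, θ + 4 * g)) (w' := (r, θ)) ((lift_zero z₀ (θ + 4 * g) θ).trans (precomp_one _).symm)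
    ⟨⟨fun t : I => (t * r, θ + 4 * g), by fun_prop⟩, by simp, by simp⟩
    ⟨⟨fun t : I => (t * r, θ), by fun_prop⟩, by simp, by simp⟩ fun t => polar_add hg _ _
  rw [h, precomp_one]

/-- One element serves for the whole edge: the two points move along the glued edges with the same
image. -/
theorem exists_edgeLoop (g : ℕ) (z₀ : I × ℝ) (m : ℕ) :
    ∃ k : FundamentalGroup (ModelSurface g) (polar g z₀), IsLeadingEdge g m → ∀ s : I,
      lift (polar g) z₀ (1, m + s) = precomp k (lift (polar g) z₀ (1, m + 3 - s)) := by
  by_cases hm : IsLeadingEdge g m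
  · have h0 := polar_edge hm 0
    obtain ⟨k, hk⟩ := exists_lift_eq_precomp (polar g) z₀ h0
    refine ⟨k, fun _ s => ?_⟩
    refine lift_eq_precomp_of_path (polar g) z₀ hk
      ⟨⟨fun t : I => ((1 : I), (m + (t * s : I) : ℝ)), by fun_prop⟩, by simp, by simp⟩
      ⟨⟨fun t : I => ((1 : I), (m + 3 - (t * s : I) : ℝ)), by fun_prop⟩, by simp, by simp⟩
      fun t => polar_edge hm (t * s)
  · exact ⟨1, fun h => absurd h hm⟩

/-- The element of the fundamental group which accounts for the identification of the edges `m`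
and `m + 2`. -/
noncomputable def edgeLoop (g : ℕ) (z₀ : I × ℝ) (m : ℕ) :
    FundamentalGroup (ModelSurface g) (polar g z₀) :=
  (exists_edgeLoop g z₀ m).choose

theorem lift_edge {m : ℕ} (hm : IsLeadingEdge g m) (z₀ : I × ℝ) (s : I) :
    lift (polar g) z₀ (1, m + s) =
      precomp (edgeLoop g z₀ m) (lift (polar g) z₀ (1, m + 3 - s)) :=
  (exists_edgeLoop g z₀ m).choose_spec hm s

/-- Having lifts that differ by an element of the subgroup is an equivalence relation, so only the
elementary identifications need checking. -/
theorem closure_edgeLoop (hg : 0 < g) (z₀ : I × ℝ) :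
    Subgroup.closure (edgeLoop g z₀ '' {m | IsLeadingEdge g m}) = ⊤ := by
  refine eq_top_of_isNullChart (isQuotientMap_polar hg) (fun z w hzw => ?_) (exists_isNullChart hg)
  refine rel_of_polar_eq_of_edge hg (R := fun z w => ∃ k ∈ Subgroup.closure (edgeLoop g z₀ ''
    {m | IsLeadingEdge g m}), lift (polar g) z₀ z = precomp k (lift (polar g) z₀ w))
    ⟨fun z => ⟨1, one_mem _, (precomp_one _).symm⟩, ?_, ?_⟩ ?_ ?_ ?_ hzw
  · rintro z w ⟨k, hk, h⟩
    exact ⟨k⁻¹, inv_mem hk, eq_precomp_inv h⟩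
  · rintro z w x ⟨k, hk, h⟩ ⟨l, hl, h'⟩
    exact ⟨l * k, mul_mem hl hk, by rw [h, h', precomp_precomp]⟩
  · exact fun θ θ' => ⟨1, one_mem _, by rw [precomp_one, lift_zero z₀ θ θ']⟩
  · exact fun r θ => ⟨1, one_mem _, by rw [precomp_one, lift_add hg]⟩
  · exact fun m hm s => ⟨_, Subgroup.subset_closure (mem_image_of_mem _ hm), lift_edge hm z₀ s⟩

theorem isLeadingEdge_a {j : ℕ} (hj : j < g) : IsLeadingEdge g (4 * j) := ⟨j, hj, Or.inl rfl⟩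

theorem isLeadingEdge_b {j : ℕ} (hj : j < g) : IsLeadingEdge g (4 * j + 1) := ⟨j, hj, Or.inr rfl⟩

/-- In each block the gluings lead from vertex `4j` to `4j + 3`, `4j + 2`, `4j + 1` and then `4j +
4`; the four steps contribute one commutator. -/
theorem lift_vertex (z₀ : I × ℝ) {j : ℕ} (hj : j ≤ g) :
    lift (polar g) z₀ (1, 0) =
      precomp (surfaceWord (fun j => edgeLoop g z₀ (4 * j)) (fun j => edgeLoop g z₀ (4 * j + 1)) j)
        (lift (polar g) z₀ (1, 4 * j)) := by
  induction j with
  | zero =>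
    have : surfaceWord (fun j => edgeLoop g z₀ (4 * j))
        (fun j => edgeLoop g z₀ (4 * j + 1)) 0 = 1 :=
      rfl
    rw [this, precomp_one]
    simp
  | succ j ih =>
    have a0 := lift_edge (isLeadingEdge_a (show j < g by lia)) z₀ 0
    have a1 := lift_edge (isLeadingEdge_a (show j < g by lia)) z₀ 1
    have b0 := lift_edge (isLeadingEdge_b (show j < g by lia)) z₀ 0
    have b1 := lift_edge (isLeadingEdge_b (show j < g by lia)) z₀ 1
    simp only [Nat.cast_add, Nat.cast_mul, Nat.cast_ofNat, Nat.cast_one, Set.Icc.coe_zero,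
      Set.Icc.coe_one] at a0 a1 b0 b1
    rw [show (4 * j + 3 - 1 : ℝ) = 4 * j + 2 by ring] at a1
    rw [show (4 * j + 1 + 3 - 1 : ℝ) = 4 * j + 3 by ring,
      show (4 * j + 1 + 1 : ℝ) = 4 * j + 2 by ring] at b1
    rw [add_zero, sub_zero] at a0
    rw [add_zero, sub_zero, show (4 * j + 1 + 3 : ℝ) = 4 * j + 4 by ring] at b0
    rw [ih (by lia), a0, eq_precomp_inv b1, eq_precomp_inv a1, b0]
    simp only [precomp_precomp]
    push_cast
    rw [show (4 * (j + 1) : ℝ) = 4 * j + 4 by ring]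
    congr 1

/-- After a full turn the lift of the vertex returns to itself, and the action on the universal
cover is free. -/
theorem surfaceWord_edgeLoop (hg : 0 < g) (z₀ : I × ℝ) :
    surfaceWord (fun j => edgeLoop g z₀ (4 * j)) (fun j => edgeLoop g z₀ (4 * j + 1)) g = 1 := by
  have h1 := lift_vertex z₀ (le_refl g)
  have h2 := lift_add hg z₀ 1 0
  rw [zero_add] at h2
  rw [h2] at h1
  exact precomp_injective _ (h1.symm.trans (precomp_one _).symm)

/-- Turns potentials on the edges and vertices of the polygon into periodic functions of the floor
of the angle. -/
theorem exists_periodic {T : Type*} {n : ℕ} (hn : 0 < n) (f : ℕ → T) (hf : f n = f 0) :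
    ∃ F : ℤ → T, (∀ k, F (k + n) = F k) ∧ ∀ k ≤ n, F k = f k := by
  refine ⟨fun k => f (k % n).toNat, fun k => by simp, fun k hk => ?_⟩
  rcases hk.lt_or_eq with h | rfl
  · simp only
    rw [← Int.natCast_mod, Int.toNat_natCast, Nat.mod_eq_of_lt h]
  · simpa using hf.symm

/-! ### Potentials realizing a solution of the surface relation. -/

section Potential

variable {Γ : Type*} [Group Γ] (A B : ℕ → Γ)

/-- The potential on the edges. -/
def edgePotential (m : ℕ) : Γ :=
  if m % 4 = 2 then A (m / 4) else if m % 4 = 3 then B (m / 4) else 1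

/-- The potential at the vertices. -/
def vertexPotential (m : ℕ) : Γ :=
  (if m % 4 = 1 then (A (m / 4))⁻¹ * (B (m / 4))⁻¹ * A (m / 4)
    else if m % 4 = 2 then (B (m / 4))⁻¹ * A (m / 4)
    else if m % 4 = 3 then A (m / 4) else 1) * surfaceWord A B (m / 4)

theorem edgePotential_spec (j : ℕ) : edgePotential A B (4 * j) = 1 ∧
    edgePotential A B (4 * j + 1) = 1 ∧ edgePotential A B (4 * j + 2) = A j ∧
    edgePotential A B (4 * j + 3) = B j := by
  refine ⟨?_, ?_, ?_, ?_⟩ <;> unfold edgePotential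
  · rw [if_neg (by lia), if_neg (by lia)]
  · rw [if_neg (by lia), if_neg (by lia)]
  · rw [if_pos (by lia), show (4 * j + 2) / 4 = j by lia]
  · rw [if_neg (by lia), if_pos (by lia), show (4 * j + 3) / 4 = j by lia]

theorem vertexPotential_spec (j : ℕ) :
    vertexPotential A B (4 * j) = surfaceWord A B j ∧
    vertexPotential A B (4 * j + 1) = (A j)⁻¹ * (B j)⁻¹ * A j * surfaceWord A B j ∧
    vertexPotential A B (4 * j + 2) = (B j)⁻¹ * A j * surfaceWord A B j ∧
    vertexPotential A B (4 * j + 3) = A j * surfaceWord A B j := by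
  refine ⟨?_, ?_, ?_, ?_⟩ <;> unfold vertexPotential
  · rw [if_neg (by lia), if_neg (by lia), if_neg (by lia), show 4 * j / 4 = j by lia, one_mul]
  · rw [if_pos (by lia), show (4 * j + 1) / 4 = j by lia]
  · rw [if_neg (by lia), if_pos (by lia), show (4 * j + 2) / 4 = j by lia]
  · rw [if_neg (by lia), if_neg (by lia), if_pos (by lia), show (4 * j + 3) / 4 = j by lia]

/-- Compatibility of the edge and vertex potentials with the gluing: the start of edge `m`, at
vertex `m`, meets the end of edge `m + 2`, at vertex `m + 3`, while vertex `m + 1` meets vertex `m +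
2`. The vertex potentials solve these equations recursively, and the surface relation closes them
up. -/
theorem potential_leadingEdge {m : ℕ} (hm : IsLeadingEdge g m) :
    (edgePotential A B m)⁻¹ * vertexPotential A B m =
      (edgePotential A B (m + 2))⁻¹ * vertexPotential A B (m + 3) ∧
    (edgePotential A B m)⁻¹ * vertexPotential A B (m + 1) =
      (edgePotential A B (m + 2))⁻¹ * vertexPotential A B (m + 2) := by
  obtain ⟨j, -, rfl | rfl⟩ := hm
  · obtain ⟨u0, u1, u2, u3⟩ := edgePotential_spec A B j
    obtain ⟨v0, v1, v2, v3⟩ := vertexPotential_spec A B j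
    rw [u0, u2, v0, v1, v2, v3]
    constructor <;> group
  · obtain ⟨u0, u1, u2, u3⟩ := edgePotential_spec A B j
    obtain ⟨v0, v1, v2, v3⟩ := vertexPotential_spec A B j
    obtain ⟨v4, -⟩ := vertexPotential_spec A B (j + 1)
    have e : 4 * j + 1 + 3 = 4 * (j + 1) := by lia
    have w : surfaceWord A B (j + 1) = B j * (A j)⁻¹ * (B j)⁻¹ * A j * surfaceWord A B j := rfl
    rw [e, v4, w, show 4 * j + 1 + 2 = 4 * j + 3 by lia, show 4 * j + 1 + 1 = 4 * j + 2 by lia,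
      u1, u3, v1, v2, v3]
    constructor <;> group

/-- Elements of a group which satisfy the surface relation define a permutation representation
of the fundamental group of the model surface. -/
theorem exists_monodromy_edgeLoop {Γ : Type} [Group Γ] (A B : ℕ → Γ) (hg : 0 < g) (z₀ : I × ℝ)
    (hAB : surfaceWord A B g = 1) :
    ∃ (Y : Type) (mon : FundamentalGroup (ModelSurface g) (polar g z₀) →* Equiv.Perm Y) (y : Γ → Y),
      Function.Injective y ∧ ∀ j < g, ∀ γ, mon (edgeLoop g z₀ (4 * j)) (y γ) = y (A j * γ) ∧
        mon (edgeLoop g z₀ (4 * j + 1)) (y γ) = y (B j * γ) := by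
  have hu0 : edgePotential A B (4 * g) = edgePotential A B 0 := by
    have h0 := edgePotential_spec A B 0
    rw [(edgePotential_spec A B g).1]
    exact h0.1.symm
  have hv0 : vertexPotential A B (4 * g) = vertexPotential A B 0 := by
    have h0 := vertexPotential_spec A B 0
    rw [(vertexPotential_spec A B g).1, hAB]
    exact h0.1.symm
  obtain ⟨u, hu, huk⟩ := exists_periodic (by lia) _ hu0
  obtain ⟨v, hv, hvk⟩ := exists_periodic (by lia) _ hv0
  push_cast at hu hv
  have key : ∀ m, IsLeadingEdge g m → (u m)⁻¹ * v m = (u (m + 2))⁻¹ * v (m + 3) ∧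
      (u m)⁻¹ * v (m + 1) = (u (m + 2))⁻¹ * v (m + 2) := by
    intro m hm
    have hm' : m + 3 ≤ 4 * g := by obtain ⟨j, hj, h⟩ := hm; lia
    have := potential_leadingEdge A B hm
    rw [← huk m (by lia), ← huk (m + 2) (by lia), ← hvk m (by lia), ← hvk (m + 1) (by lia),
      ← hvk (m + 2) (by lia), ← hvk (m + 3) (by lia)] at this
    push_cast at this
    exact this
  -- Three charts: the interior with potential `1`, the sectors over edges with potential indexed by
  -- the edge, and the sectors around vertices with potential indexed by the nearest vertex.
  let D : Fin 3 → Set (I × ℝ) := ![interiorDomain, edgeDomain, vertexDomain]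
  let F : Fin 3 → I × ℝ → Γ := ![fun _ => 1, fun z => u ⌊z.2⌋, fun z => v ⌊z.2 + 1 / 2⌋]
  have hrel : ∀ z w, polar g z = polar g w → (∀ i, z ∈ D i ↔ w ∈ D i) ∧ ∀ i j, z ∈ D i → z ∈ D j →
      (F j z)⁻¹ * F i z = (F j w)⁻¹ * F i w := by
    intro z w hzw
    refine rel_of_polar_eq_of_edge hg (R := fun z w => (∀ i, z ∈ D i ↔ w ∈ D i) ∧
      ∀ i j, z ∈ D i → z ∈ D j → (F j z)⁻¹ * F i z = (F j w)⁻¹ * F i w) ⟨?_, ?_, ?_⟩ ?_ ?_ ?_ hzw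
    · exact fun z => ⟨fun _ => Iff.rfl, fun _ _ _ _ => rfl⟩
    · exact fun h => ⟨fun i => (h.1 i).symm,
        fun i j hi hj => (h.2 i j ((h.1 i).mpr hi) ((h.1 j).mpr hj)).symm⟩
    · exact fun h h' => ⟨fun i => (h.1 i).trans (h'.1 i), fun i j hi hj =>
        (h.2 i j hi hj).trans (h'.2 i j ((h.1 i).mp hi) ((h.1 j).mp hj))⟩
    · intro θ θ'
      have h1 : ∀ θ, ((0, θ) : I × ℝ) ∉ edgeDomain := fun θ h => h.1 rfl
      have h2 : ∀ θ, ((0, θ) : I × ℝ) ∉ vertexDomain := fun θ h => h.1 rfl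
      refine ⟨fun i => ?_, fun i j hi hj => ?_⟩
      · fin_cases i
        · exact Iff.rfl
        · exact iff_of_false (h1 θ) (h1 θ')
        · exact iff_of_false (h2 θ) (h2 θ')
      · fin_cases i
        · fin_cases j
          · rfl
          · exact absurd hj (h1 θ)
          · exact absurd hj (h2 θ)
        · exact absurd hi (h1 θ)
        · exact absurd hi (h2 θ)
    · intro r θ
      have hF : ∀ i, F i (r, θ + 4 * g) = F i (r, θ) := by
        intro i
        fin_cases i
        · rfl
        · change u ⌊θ + 4 * g⌋ = u ⌊θ⌋
          rw [floor_add_period, hu]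
        · change v ⌊θ + 4 * g + 1 / 2⌋ = v ⌊θ + 1 / 2⌋
          rw [floor_add_period_half, hv]
      refine ⟨fun i => ?_, fun i j _ _ => by rw [hF, hF]⟩
      fin_cases i
      · exact Iff.rfl
      · exact mem_edgeDomain_add g r θ
      · exact mem_vertexDomain_add g r θ
    · intro m hm s
      have h1 : ∀ θ, ((1, θ) : I × ℝ) ∉ interiorDomain := fun θ h => h rfl
      have huv : ((1, m + s) : I × ℝ) ∈ edgeDomain → ((1, m + s) : I × ℝ) ∈ vertexDomain →
          (u ⌊(m + s : ℝ)⌋)⁻¹ * v ⌊(m + s + 1 / 2 : ℝ)⌋ =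
          (u ⌊(m + 3 - s : ℝ)⌋)⁻¹ * v ⌊(m + 3 - s + 1 / 2 : ℝ)⌋ := by
        intro he hv
        rw [← Int.cast_natCast (R := ℝ) m, mem_edgeDomain_one] at he
        rw [← Int.cast_natCast (R := ℝ) m, mem_vertexDomain_one] at hv
        have e1 : ⌊(m + s : ℝ)⌋ = m := floor_add_coe (m := m) he.1.le he.2
        have e2 : ⌊(m + 3 - s : ℝ)⌋ = m + 2 := by
          rw [Int.floor_eq_iff]
          push_cast
          constructor <;> linarith
        rcases lt_or_gt_of_ne hv with hs | hs
        · have e3 : ⌊(m + s + 1 / 2 : ℝ)⌋ = m := floor_add_half_of_lt (m := m) he.1.le hs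
          have e4 : ⌊(m + 3 - s + 1 / 2 : ℝ)⌋ = m + 3 := by
            rw [Int.floor_eq_iff]
            push_cast
            constructor <;> linarith
          rw [e1, e2, e3, e4]
          exact (key m hm).1
        · have e3 : ⌊(m + s + 1 / 2 : ℝ)⌋ = m + 1 :=
            floor_add_half_of_ge (m := m) hs.le he.2.le
          have e4 : ⌊(m + 3 - s + 1 / 2 : ℝ)⌋ = m + 2 := by
            rw [Int.floor_eq_iff]
            push_cast
            constructor <;> linarith
          rw [e1, e2, e3, e4]
          exact (key m hm).2
      refine ⟨fun i => ?_, fun i j hi hj => ?_⟩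
      · fin_cases i
        · exact iff_of_false (h1 _) (h1 _)
        · exact mem_edgeDomain_edge m s
        · exact mem_vertexDomain_edge m s
      · fin_cases i
        · exact absurd hi (h1 _)
        · fin_cases j
          · exact absurd hj (h1 _)
          · exact (inv_mul_cancel _).trans (inv_mul_cancel _).symm
          · have := congrArg (·⁻¹) (huv hi hj)
            simp only [mul_inv_rev, inv_inv] at this
            exact this
        · fin_cases j
          · exact absurd hj (h1 _)
          · exact huv hj hi
          · exact (inv_mul_cancel _).trans (inv_mul_cancel _).symm
  obtain ⟨Y, mon, y, hy, hmon⟩ := exists_monodromy z₀ (isQuotientMap_polar hg) D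
    (fun i => by
      fin_cases i
      exacts [isOpen_interiorDomain, isOpen_edgeDomain, isOpen_vertexDomain])
    (fun z => by
      rcases mem_domain z with h | h | h
      exacts [⟨0, h⟩, ⟨1, h⟩, ⟨2, h⟩])
    (fun i z w hzw => ((hrel z w hzw).1 i).mp) F
    (fun i z hz => by
      fin_cases i
      · exact Filter.Eventually.of_forall fun _ => rfl
      · exact (eventually_edgeDomain hz).mono fun w h => congrArg u h.2
      · exact (eventually_vertexDomain hz).mono fun w h => congrArg v h.2)
    (fun i j z w hzw => (hrel z w hzw).2 i j)
  refine ⟨Y, mon, y, hy, fun j hj γ => ?_⟩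
  have hedge : ∀ m, IsLeadingEdge g m →
      ∀ γ, mon (edgeLoop g z₀ m) (y γ) = y (u (m + 2) * (u m)⁻¹ * γ) := by
    intro m hm γ
    -- Any interior point of the edge would do: the monodromy is read off in the edge chart.
    let s : I := ⟨1 / 2, by norm_num, by norm_num⟩
    have hs : ((1, m + s) : I × ℝ) ∈ edgeDomain := by
      rw [← Int.cast_natCast (R := ℝ) m, mem_edgeDomain_one]
      change (0 : ℝ) < 1 / 2 ∧ (1 / 2 : ℝ) < 1
      norm_num
    have e1 : ⌊(m + s : ℝ)⌋ = m := floor_add_coe (m := m) (s := 1 / 2) (by norm_num) (by norm_num)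
    have e2 : ⌊(m + 3 - s : ℝ)⌋ = m + 2 := by
      rw [Int.floor_eq_iff]
      change ((m + 2 : ℤ) : ℝ) ≤ m + 3 - 1 / 2 ∧ (m + 3 - 1 / 2 : ℝ) < ((m + 2 : ℤ) : ℝ) + 1
      push_cast
      constructor <;> linarith
    have := hmon 1 _ _ _ hs ((mem_edgeDomain_edge m s).mp hs) (lift_edge hm z₀ s) γ
    rw [this]
    change y (u ⌊(m + 3 - s : ℝ)⌋ * (u ⌊(m + s : ℝ)⌋)⁻¹ * γ) = _
    rw [e1, e2]
  obtain ⟨u0, u1, u2, u3⟩ := edgePotential_spec A B j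
  rw [← huk _ (by lia)] at u0 u1 u2 u3
  push_cast at u0 u1 u2 u3
  rw [hedge _ (isLeadingEdge_a hj), hedge _ (isLeadingEdge_b hj)]
  push_cast
  rw [u0, u1, u2, show (4 * j + 1 + 2 : ℤ) = 4 * j + 3 by ring, u3, inv_one, mul_one, mul_one]
  exact ⟨rfl, rfl⟩

end Potential

/-- The fundamental group of the model surface is the surface group. -/
theorem nonempty_mulEquiv_surfaceGroup (h : ℕ) (z₀ : I × ℝ) :
    Nonempty (SurfaceGroup h ≃* FundamentalGroup (ModelSurface (h + 1)) (polar (h + 1) z₀)) := by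
  have hg : 0 < h + 1 := h.succ_pos
  obtain ⟨Φ, hΦa, hΦb⟩ := SurfaceGroup.exists_hom _ _ (surfaceWord_edgeLoop hg z₀)
  refine ⟨MulEquiv.ofBijective Φ ⟨?_, ?_⟩⟩
  · obtain ⟨Y, mon, y, hy, hmon⟩ := exists_monodromy_edgeLoop _ _ hg z₀
      (SurfaceGroup.surfaceWord_gen h)
    -- The elements that act through `Φ` by left multiplication on the copy `y` of the surface
    -- group. They contain the generators, so `Φ δ = 1` forces `y δ = y 1`.
    let K : Subgroup (SurfaceGroup h) :=
      { carrier := {δ | ∀ γ, mon (Φ δ) (y γ) = y (δ * γ)}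
        one_mem' := fun γ => by rw [map_one, map_one, one_mul]; rfl
        mul_mem' := fun {δ ε} hδ hε γ => by
          rw [map_mul, map_mul, Equiv.Perm.mul_apply, hε, hδ, mul_assoc]
        inv_mem' := fun {δ} hδ γ => by
          rw [map_inv, map_inv, Equiv.Perm.inv_eq_iff_eq, hδ, mul_inv_cancel_left] }
    have hK : K = ⊤ := by
      refine SurfaceGroup.eq_top_of_gen_mem K (fun j hj γ => ?_) (fun j hj γ => ?_)
      · rw [hΦa j hj]
        exact (hmon j (by lia) γ).1
      · rw [hΦb j hj]
        exact (hmon j (by lia) γ).2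
    rw [injective_iff_map_eq_one]
    intro δ hδ
    have h1 : δ ∈ K := hK ▸ Subgroup.mem_top δ
    have h2 := h1 1
    rw [hδ, map_one, Equiv.Perm.one_apply, mul_one] at h2
    exact (hy h2).symm
  · rw [← MonoidHom.range_eq_top, eq_top_iff, ← closure_edgeLoop hg z₀, Subgroup.closure_le]
    rintro _ ⟨m, ⟨j, hj, rfl | rfl⟩, rfl⟩
    · exact ⟨_, hΦa j (by lia)⟩
    · exact ⟨_, hΦb j (by lia)⟩

end ModelSurface

/-! ### Fundamental groups of surfaces and of surface bundles -/

/-- A homeomorphism induces a bijection of fundamental groups. -/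
theorem Homeomorph.fundamentalGroup_map_bijective {S T : Type*} [TopologicalSpace S]
    [TopologicalSpace T] (e : S ≃ₜ T) (s : S) :
    Function.Bijective (FundamentalGroup.map (e : C(S, T)) s) := by
  constructor
  · intro p q h
    obtain ⟨γ, rfl⟩ := Path.Homotopic.Quotient.mk_surjective p
    obtain ⟨δ, rfl⟩ := Path.Homotopic.Quotient.mk_surjective q
    have h1 : (γ.map e.continuous).Homotopic (δ.map e.continuous) :=
      Path.Homotopic.Quotient.eq.mp h
    have h2 := (h1.map (e.symm : C(T, S))).pathCast (e.symm_apply_apply s).symm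
      (e.symm_apply_apply s).symm
    refine Path.Homotopic.Quotient.eq.mpr ?_
    convert! h2 using 1
    · ext t; exact (e.symm_apply_apply _).symm
    · ext t; exact (e.symm_apply_apply _).symm
  · intro p
    obtain ⟨γ, rfl⟩ := Path.Homotopic.Quotient.mk_surjective p
    refine ⟨Path.Homotopic.Quotient.mk ((γ.map e.symm.continuous).cast
      (e.symm_apply_apply s).symm (e.symm_apply_apply s).symm), ?_⟩
    refine congrArg Path.Homotopic.Quotient.mk (Path.ext (funext fun t => ?_))
    exact e.apply_symm_apply _

theorem IsClosedSurfaceOfGenusGtOne.exists_mulEquiv {S : Type*} [TopologicalSpace S]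
    (hS : IsClosedSurfaceOfGenusGtOne S) (s : S) :
    ∃ h, 1 ≤ h ∧ Nonempty (SurfaceGroup h ≃* FundamentalGroup S s) := by
  obtain ⟨g, hg, ⟨e⟩⟩ := hS
  obtain ⟨h, rfl⟩ : ∃ h, g = h + 1 := ⟨g - 1, by lia⟩
  refine ⟨h, by lia, ?_⟩
  obtain ⟨z, hz⟩ := (ModelSurface.isQuotientMap_polar h.succ_pos).surjective (e s)
  obtain ⟨φ⟩ := ModelSurface.nonempty_mulEquiv_surfaceGroup h z
  rw [hz] at φ
  exact ⟨φ.trans (MulEquiv.ofBijective _ (e.fundamentalGroup_map_bijective s)).symm⟩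

/-- A nontrivial normal subgroup of the fundamental group of a closed surface of genus greater than
one contains a free group of rank two. -/
theorem IsClosedSurfaceOfGenusGtOne.exists_injective_of_normal {S : Type*} [TopologicalSpace S]
    (hS : IsClosedSurfaceOfGenusGtOne S) (s : S) (K : Subgroup (FundamentalGroup S s)) [K.Normal]
    (hK : K ≠ ⊥) : ∃ f : FreeGroup (Fin 2) →* FundamentalGroup S s, Function.Injective f ∧
      ∀ w, f w ∈ K := by
  obtain ⟨h, hh, ⟨φ⟩⟩ := hS.exists_mulEquiv s
  obtain ⟨f, hf, hfK⟩ := SurfaceGroup.exists_injective_of_normal hh (K.comap φ.toMonoidHom)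
    (fun h0 => hK (by
      rw [eq_bot_iff]
      intro x hx
      have h1 : φ.symm x ∈ K.comap φ.toMonoidHom := by
        rw [Subgroup.mem_comap]
        exact (φ.apply_symm_apply x).symm ▸ hx
      rw [h0, Subgroup.mem_bot] at h1
      rw [Subgroup.mem_bot, ← φ.apply_symm_apply x, h1, map_one]))
  exact ⟨φ.toMonoidHom.comp f, φ.injective.comp hf, hfK⟩

instance SurfaceGroup.nontrivial (h : ℕ) : Nontrivial (SurfaceGroup h) :=
  (SemidirectProduct.inr_injective : Function.Injective
    (SemidirectProduct.inr : Multiplicative ℤ →* SurfaceGroup h)).nontrivial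

/-- The centre is an abelian normal subgroup, hence trivial. -/
theorem FreeGroup.center_eq_bot {α : Type*} [Nontrivial α] :
    Subgroup.center (FreeGroup α) = ⊥ := by
  by_contra h
  obtain ⟨x, hx, y, -, hxy⟩ := FreeGroup.not_commute_of_normal _ h
  exact hxy (Subgroup.mem_center_iff.mp hx y).symm

/-- The fundamental group of the total space of a surface bundle contains a free group of rank two
which dies in the fundamental group of the base. -/
theorem IsFibreBundle.exists_injective_ker {F X B : Type*} [TopologicalSpace F]
    [TopologicalSpace X] [TopologicalSpace B] {p : C(X, B)} (hp : IsFibreBundle F p)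
    (hF : IsClosedSurfaceOfGenusGtOne F) (x₀ : X) :
    ∃ f : FreeGroup (Fin 2) →* FundamentalGroup X x₀, Function.Injective f ∧
      ∀ w, f w ∈ (FundamentalGroup.map p x₀).ker := by
  obtain ⟨e, he⟩ := hp (p x₀)
  let i : C(F, X) := ⟨fun f => e.toOpenPartialHomeomorph.symm (p x₀, f),
    e.continuousOn_invFun.comp_continuous (by fun_prop) fun f => by
      rw [e.target_eq]
      exact ⟨he, trivial⟩⟩
  have hi : ∀ f, p (i f) = p x₀ := fun f => e.proj_symm_apply' he
  have hei : ∀ f, (e (i f)).2 = f := fun f => by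
    change (e (e.toOpenPartialHomeomorph.symm (p x₀, f))).2 = f
    rw [e.apply_symm_apply' he]
  have hx₀ : i (e x₀).2 = x₀ := e.symm_apply_mk_proj (by rw [e.mem_source]; exact he)
  have : Nontrivial (FundamentalGroup F (e x₀).2) := by
    obtain ⟨h, -, ⟨φ⟩⟩ := hF.exists_mulEquiv (e x₀).2
    exact φ.symm.toEquiv.nontrivial
  obtain ⟨f, hf, -⟩ := hF.exists_injective_of_normal (e x₀).2 ⊤ top_ne_bot
  let ι : FundamentalGroup F (e x₀).2 →* FundamentalGroup X x₀ := FundamentalGroup.mapOfEq i hx₀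
  -- A loop of the fibre that dies in `X` is central in the fundamental group of the fibre.
  have hker : ∀ c ∈ ι.ker, ∀ d, c * d = d * c := by
    intro c hc d
    obtain ⟨γ, rfl⟩ := Path.Homotopic.Quotient.mk_surjective c
    obtain ⟨δ, rfl⟩ := Path.Homotopic.Quotient.mk_surjective d
    rw [MonoidHom.mem_ker, FundamentalGroup.mapOfEq_apply] at hc
    have h1 : ((Path.Homotopic.Quotient.mk (γ.map i.continuous)).cast hx₀.symm hx₀.symm) =
      Path.Homotopic.Quotient.mk (Path.refl x₀) := hc
    rw [← Path.Homotopic.Quotient.mk_cast] at h1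
    have h2 := (Path.Homotopic.Quotient.eq.mp h1).pathCast hx₀ hx₀
    have h3 : (γ.map i.continuous).Homotopic (Path.refl (i (e x₀).2)) := by
      convert! h2 using 1
      ext t
      exact hx₀
    exact (Path.Homotopic.Quotient.eq.mpr
      (hp.homotopic_trans_comm p.continuous e he i hi hei γ δ h3)).symm
  refine ⟨ι.comp f, ?_, fun w => ?_⟩
  -- An element of `F₂` killed by `ι ∘ f` is central in `F₂`, hence trivial.
  · rw [injective_iff_map_eq_one]
    intro w hw
    rw [← Subgroup.mem_bot, ← FreeGroup.center_eq_bot, Subgroup.mem_center_iff]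
    refine fun v => hf ?_
    rw [map_mul, map_mul]
    exact (hker (f w) hw (f v)).symm
  · rw [MonoidHom.mem_ker]
    obtain ⟨γ, hγ⟩ := Path.Homotopic.Quotient.mk_surjective (f w)
    have h1 : ι (f w) =
        (Path.Homotopic.Quotient.mk (γ.map i.continuous)).cast hx₀.symm hx₀.symm := by
      rw [← hγ]
      exact FundamentalGroup.mapOfEq_apply i hx₀ _
    change FundamentalGroup.map p x₀ (ι (f w)) = 1
    rw [h1, ← Path.Homotopic.Quotient.mk_cast]
    refine congrArg Path.Homotopic.Quotient.mk (Path.ext (funext fun t => ?_))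
    exact hi (γ t)

/-! ### Trivial monodromy, centralizers and the product of two free groups. -/

theorem extensionMonodromy_mk {G : Type*} [Group G] (R : Subgroup G) [R.Normal] (x : G) :
    extensionMonodromy R (x : G ⧸ R) =
      QuotientGroup.mk' (MulAut.conj : R →* MulAut R).range (MulAut.conjNormal x) :=
  rfl

/-- An element of the quotient with trivial monodromy lifts to the centralizer of the kernel. -/
theorem exists_mem_centralizer_of_extensionMonodromy_eq_one {G : Type*} [Group G] {R : Subgroup G}
    [R.Normal] {x : G} (hx : extensionMonodromy R (x : G ⧸ R) = 1) :
    ∃ c ∈ Subgroup.centralizer (R : Set G), c⁻¹ * x ∈ R := by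
  rw [extensionMonodromy_mk, QuotientGroup.mk'_apply, QuotientGroup.eq_one_iff] at hx
  obtain ⟨r, hr⟩ := hx
  -- Conjugation by `x` agrees on `R` with conjugation by `r ∈ R`, so `r⁻¹ x` acts trivially on `R`.
  refine ⟨(r : G)⁻¹ * x, ?_, ?_⟩
  · rw [Subgroup.mem_centralizer_iff]
    intro y hy
    have h1 := congrArg (fun φ : MulAut R => (φ ⟨y, hy⟩ : G)) hr
    simp only [MulAut.conj_apply, MulAut.conjNormal_apply, Subgroup.coe_mul,
      Subgroup.coe_inv] at h1
    have h2 : x * y = r * y * (r : G)⁻¹ * x := by rw [h1]; group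
    rw [mul_assoc, h2]
    group
  · have : ((r : G)⁻¹ * x)⁻¹ * x = x⁻¹ * r * x⁻¹⁻¹ := by group
    rw [this]
    exact Subgroup.Normal.conj_mem inferInstance _ r.2 _

/-- If the kernel of an epimorphism contains a free group of rank two and a free group of rank two
in the quotient has trivial monodromy, the group contains a product of two free groups. -/
theorem exists_prod_injective_of_monodromy {G Q : Type*} [Group G] [Group Q] (π : G →* Q)
    (hπ : Function.Surjective π) (f : FreeGroup (Fin 2) →* G) (hf : Function.Injective f)
    (hfR : ∀ w, f w ∈ π.ker) (j : FreeGroup (Fin 2) →* Q) (hj : Function.Injective j)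
    (hjR : ∀ w, extensionMonodromy π.ker
      ((QuotientGroup.quotientKerEquivOfSurjective π hπ).symm (j w)) = 1) :
    ∃ F : FreeGroup (Fin 2) × FreeGroup (Fin 2) →* G, Function.Injective F := by
  have hc : ∀ i : Fin 2, ∃ c ∈ Subgroup.centralizer (π.ker : Set G), π c = j (FreeGroup.of i) := by
    intro i
    obtain ⟨x, hx⟩ := hπ (j (FreeGroup.of i))
    have h1 : (QuotientGroup.quotientKerEquivOfSurjective π hπ).symm (j (FreeGroup.of i)) =
        (x : G ⧸ π.ker) := by
      rw [MulEquiv.symm_apply_eq, ← hx]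
      rfl
    obtain ⟨c, hc, hcx⟩ := exists_mem_centralizer_of_extensionMonodromy_eq_one
      (h1 ▸ hjR (FreeGroup.of i))
    refine ⟨c, hc, ?_⟩
    rw [MonoidHom.mem_ker, map_mul, map_inv, inv_mul_eq_one] at hcx
    rw [hcx, hx]
  choose c hc hcj using hc
  -- Only the two generators have to be lifted to the centralizer; freeness provides the
  -- homomorphism.
  let f' : FreeGroup (Fin 2) →* G := FreeGroup.lift c
  have hf' : ∀ w, f' w ∈ Subgroup.centralizer (π.ker : Set G) := by
    intro w
    have h1 : f'.range ≤ Subgroup.centralizer (π.ker : Set G) := by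
      refine FreeGroup.range_lift_le ?_
      rintro _ ⟨i, rfl⟩
      exact hc i
    exact h1 ⟨w, rfl⟩
  have hfj : π.comp f' = j := by
    ext i
    simp [f', hcj]
  have hcomm : ∀ v w, Commute (f v) (f' w) := fun v w =>
    Subgroup.mem_centralizer_iff.mp (hf' w) (f v) (hfR v)
  refine ⟨f.noncommCoprod f' hcomm, ?_⟩
  rw [injective_iff_map_eq_one]
  rintro ⟨v, w⟩ h
  rw [MonoidHom.noncommCoprod_apply] at h
  have h1 := congrArg π h
  rw [map_mul, MonoidHom.mem_ker.mp (hfR v), one_mul, ← MonoidHom.comp_apply, hfj, map_one] at h1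
  obtain rfl : w = 1 := hj (h1.trans (map_one j).symm)
  rw [map_one, mul_one] at h
  obtain rfl : v = 1 := hf (h.trans (map_one f).symm)
  rfl

theorem mainTheorem11 {F X B : Type*} [TopologicalSpace F] [TopologicalSpace X]
    [TopologicalSpace B] (p : C(X, B)) (hp : IsSurfaceBundleOverSurface F p) (x₀ : X)
    (hmono : ¬ Function.Injective (surfaceBundleMonodromy hp x₀)) :
    (∃ f : FreeGroup (Fin 2) × FreeGroup (Fin 2) →* FundamentalGroup X x₀,
      Function.Injective f) ∧
    ¬ IsCoherentGroup (FundamentalGroup X x₀) := by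
  have hprod : ∃ f : FreeGroup (Fin 2) × FreeGroup (Fin 2) →* FundamentalGroup X x₀,
      Function.Injective f := by
    have := hp.fibre.pathConnectedSpace
    obtain ⟨f, hf, hfR⟩ := hp.isFibreBundle.exists_injective_ker hp.fibre x₀
    -- Failure of injectivity enters here only: the kernel of the monodromy is a nontrivial normal
    -- subgroup of the surface group of the base.
    obtain ⟨j, hj, hjK⟩ := hp.base.exists_injective_of_normal (p x₀)
      (surfaceBundleMonodromy hp x₀).ker (fun h => hmono ((MonoidHom.ker_eq_bot_iff _).mp h))
    exact exists_prod_injective_of_monodromy _ (hp.isFibreBundle.map_surjective x₀) f hf hfR j hj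
      hjK
  refine ⟨hprod, fun hX => ?_⟩
  obtain ⟨f, hf⟩ := hprod
  exact FreeProduct.not_isCoherentGroup (hX.of_injective f hf)
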